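/- **Model.** Let $\Omega$ be a compact metric space with its Borel $\sigma$-algebra, and let $\mu_0\neq\mu_1$ be mutually absolutely continuous Borel probability measures on $\Omega$. Let $G=(V,E)$ be a connected, undirected, simple graph, finite or infinite, all of whose degrees are finite. The state of the world $S\in\{0,1\}$ is uniformly distributed and, conditioned on $S$, the private signals $W_i\in\Omega$ ($i\in V$) are i.i.d. with law $\mu_S$; that is, $(S,(W_i)_{i\in V})\sim \mathbb P=\tfrac12\delta_0\times\mu_0^V+\tfrac12\delta_1\times\mu_1^V$. At each time $t=0,1,2,\dots$ every agent $i\in V$ knows $H^i_t$, which consists of its private signal $W_i$ and of the actions $A^j_{t'}$, $t'<t$, of $i$ itself and of its neighbours $j$; it takes the myopic Bayesian action $$A^i_t=\operatorname{argmax}_{s\in\{0,1\}}\mathbb P(S=s\mid H^i_t)\in\{0,1\}.$$ In cases of indifference the action is chosen by a fixed deterministic measurable rule, the same for all agents on all graphs, as a function of $t$, the agent's own signal and past actions, and the unlabelled collection (multiset) of its neighbours' past actions. Let $A^i_\infty\subseteq\{0,1\}$ be the set of accumulation points of the sequence $(A^i_t)_t$. We write $p(G)=p$ if $\lim_{t\to\infty}\mathbb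 P(A^i_t=S)$ exists and equals $p$ for every agent $i\in V$. **Theorem.** Assume that $\mu_0,\mu_1$ (and the tie-breaking rule) are such that on every connected, undirected graph with finite degrees the agents agree in the limit: there exists a random variable $A_\infty$ such that almost surely $A^i_\infty=A_\infty$ for all agents $i$. Let $G$ be an infinite, connected, undirected graph with bounded degrees. Then $p(G)=1$, i.e. $\lim_{t\to\infty}\mathbb P(A^i_t=S)=1$ for every agent $i$; moreover, almost surely all agents learn $S$, i.e. $A^i_\infty=\{S\}$ for every $i\in V$. -/

import Mathlib

open MeasureTheory Filter Topology
open scoped ENNReal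

namespace BayesianLearning

/-- The sample space: the state of the world `S ∈ {0,1}` (`true` stands for `1`) together with the
private signals of all agents. -/
abbrev Sample (V Ω : Type*) : Type _ := Bool × (V → Ω)

/-- The law of the state and the private signals: `S` is uniform on `{0,1}`, and conditioned on
`S = s` the signals are i.i.d. with law `μ s`; that is,
`P = ½ δ₀ × μ₀^V + ½ δ₁ × μ₁^V`. -/
noncomputable def law (V : Type*) {Ω : Type*} [MeasurableSpace Ω] (μ₀ μ₁ : Measure Ω)
    [IsProbabilityMeasure μ₀] [IsProbabilityMeasure μ₁] : Measure (Sample V Ω) :=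
  (2⁻¹ : ℝ≥0∞) • (Measure.dirac false).prod (Measure.infinitePi (fun _ : V => μ₀)) +
  (2⁻¹ : ℝ≥0∞) • (Measure.dirac true).prod (Measure.infinitePi (fun _ : V => μ₁))

/-- A deterministic rule, common to all agents, that selects an action when an agent is
indifferent. It may use everything the agent has observed: the time `t`, the agent's own signal,
its own past actions, and the (unlabelled) collection of the past actions of its neighbours. -/
structure TieRule (Ω : Type*) [MeasurableSpace Ω] where
  /-- the action selected at an indifference -/
  choose : (t : ℕ) → Ω → (Fin t → Bool) → Multiset (Fin t → Bool) → Bool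
  measurable_choose : ∀ t own nbrs, Measurable (fun ω => choose t ω own nbrs)

section Model

variable {V Ω : Type*} [MeasurableSpace Ω]

/-- The sigma-algebra `σ(H^i_t)` of what agent `i` knows at time `t`, if `a s j` is the action of
agent `j` at time `s < t`: it is generated by the private signal of `i` and by the actions before
time `t` of `i` itself and of its neighbours. -/
@[reducible]
def info (G : SimpleGraph V) (t : ℕ) (a : Fin t → V → Sample V Ω → Bool) (i : V) :
    MeasurableSpace (Sample V Ω) :=
  MeasurableSpace.comap (fun x : Sample V Ω => x.2 i) inferInstance ⊔
    ⨆ j ∈ insert i (G.neighborSet i), ⨆ s : Fin t, MeasurableSpace.comap (a s j) inferInstance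

variable (μ₀ μ₁ : Measure Ω) [IsProbabilityMeasure μ₀] [IsProbabilityMeasure μ₁]

/-- The belief `B^i_t = P(S = 1 | H^i_t)` of agent `i` at time `t`, given the past actions `a`. -/
noncomputable def belief (G : SimpleGraph V) (t : ℕ) (a : Fin t → V → Sample V Ω → Bool) (i : V) :
    Sample V Ω → ℝ :=
  (law V μ₀ μ₁)[Set.indicator {x : Sample V Ω | x.1 = true} (fun _ => (1 : ℝ)) | info G t a i]

/-- The myopic Bayesian choice `argmax_s P(S = s | H^i_t)` of agent `i` at time `t`, given the past
actions `a`: the state that is more likely under the agent's belief, with ties broken by `τ`. -/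
noncomputable def myopicChoice (τ : TieRule Ω) (G : SimpleGraph V) [G.LocallyFinite] (t : ℕ)
    (a : Fin t → V → Sample V Ω → Bool) (i : V) (x : Sample V Ω) : Bool :=
  if belief μ₀ μ₁ G t a i x > 1 / 2 then true
  else if belief μ₀ μ₁ G t a i x < 1 / 2 then false
  else τ.choose t (x.2 i) (fun s => a s i x)
    ((G.neighborFinset i).val.map (fun j => fun s => a s j x))

/-- The action `A^i_t` of agent `i` at time `t` on the network `G`. -/
noncomputable def action (τ : TieRule Ω) (G : SimpleGraph V) [G.LocallyFinite] :
    ℕ → V → Sample V Ω → Bool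
  | t => myopicChoice μ₀ μ₁ τ G t (fun s : Fin t => action τ G s.1)
termination_by t => t
decreasing_by exact s.2

instance : IsProbabilityMeasure (law V μ₀ μ₁) := by
  constructor
  simp [law, ENNReal.inv_two_add_inv_two]

theorem info_le (G : SimpleGraph V) (t : ℕ) (a : Fin t → V → Sample V Ω → Bool) (i : V)
    (ha : ∀ s j, Measurable (a s j)) :
    info G t a i ≤ (inferInstance : MeasurableSpace (Sample V Ω)) := by
  refine sup_le ?_ (iSup₂_le fun j _ => iSup_le fun s => (ha s j).comap_le)
  exact Measurable.comap_le ((measurable_pi_apply i).comp measurable_snd)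

/-- The action `A^i_t` is a function of the information `H^i_t` (and a random variable), so that
all the conditional probabilities above are genuine ones. -/
theorem measurable_action (τ : TieRule Ω) (G : SimpleGraph V) [G.LocallyFinite] (t : ℕ) (i : V) :
    Measurable[info G t (fun s : Fin t => action μ₀ μ₁ τ G s.1) i] (action μ₀ μ₁ τ G t i) ∧
      Measurable (action μ₀ μ₁ τ G t i) := by
  induction t using Nat.strong_induction_on generalizing i with
  | _ t ih =>
    have hle : info G t (fun s : Fin t => action μ₀ μ₁ τ G s.1) i ≤
        (inferInstance : MeasurableSpace (Sample V Ω)) :=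
      info_le G t _ i fun s j => (ih s.1 s.2 j).2
    refine and_iff_left_of_imp (fun h => h.mono hle le_rfl) |>.2 ?_
    rw [action]
    set a : Fin t → V → Sample V Ω → Bool := fun s => action μ₀ μ₁ τ G s.1 with ha
    have hB : Measurable[info G t a i] (belief μ₀ μ₁ G t a i) :=
      stronglyMeasurable_condExp.measurable
    have hsig : Measurable[info G t a i] (fun x : Sample V Ω => x.2 i) :=
      Measurable.of_comap_le le_sup_left
    have hact : ∀ s, ∀ j ∈ insert i (G.neighborSet i), Measurable[info G t a i] (a s j) :=
      fun s j hj => Measurable.of_comap_le (le_sup_of_le_right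
        (le_iSup₂_of_le j hj (le_iSup (fun s : Fin t =>
          MeasurableSpace.comap (a s j) inferInstance) s)))
    let N := {j // j ∈ G.neighborFinset i}
    let hist : Sample V Ω → (Fin t → Bool) × (N → Fin t → Bool) :=
      fun x => (fun s => a s i x, fun j s => a s j.1 x)
    have hhist : Measurable[info G t a i] hist := by
      refine Measurable.prodMk ?_ ?_
      · exact (@measurable_pi_iff _ _ _ (info G t a i) _ _).2
          fun s => hact s i (Set.mem_insert _ _)
      · refine (@measurable_pi_iff _ _ _ (info G t a i) _ _).2 fun j =>
          (@measurable_pi_iff _ _ _ (info G t a i) _ _).2 fun s => hact s j.1 ?_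
        exact Set.mem_insert_of_mem _ ((G.mem_neighborFinset i j.1).1 j.2)
    let F : Ω × ((Fin t → Bool) × (N → Fin t → Bool)) → Bool :=
      fun q => τ.choose t q.1 q.2.1 ((G.neighborFinset i).val.attach.map (fun j => q.2.2 j))
    have hF : Measurable F :=
      measurable_from_prod_countable_left fun q => τ.measurable_choose t q.1
        ((G.neighborFinset i).val.attach.map (fun j => q.2 j))
    have htie : Measurable[info G t a i] (fun x : Sample V Ω =>
        τ.choose t (x.2 i) (fun s => a s i x)
          ((G.neighborFinset i).val.map (fun j => fun s => a s j x))) := by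
      have : (fun x : Sample V Ω => τ.choose t (x.2 i) (fun s => a s i x)
          ((G.neighborFinset i).val.map (fun j => fun s => a s j x))) =
          F ∘ fun x => (x.2 i, hist x) := by
        funext x
        simp only [F, hist, Function.comp]
        congr 1
        exact ((G.neighborFinset i).val.attach_map_val' (fun j => fun s => a s j x)).symm
      rw [this]
      exact hF.comp (hsig.prodMk hhist)
    exact Measurable.ite (measurableSet_lt measurable_const hB) measurable_const
      (Measurable.ite (measurableSet_lt hB measurable_const) measurable_const htie)

/-- The limit action set `A^i_∞`: the set of accumulation points of the sequence `A^i_t`. -/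
def limitActions (τ : TieRule Ω) (G : SimpleGraph V) [G.LocallyFinite] (i : V)
    (x : Sample V Ω) : Set Bool :=
  {b | MapClusterPt b atTop (fun t => action μ₀ μ₁ τ G t i x)}

/-- On `G` the agents agree in the limit: there is a random variable `A_∞` such that almost surely
`A^i_∞ = A_∞` for all agents `i`. -/
def LimitAgreement (τ : TieRule Ω) (G : SimpleGraph V) [G.LocallyFinite] : Prop :=
  ∃ A : Sample V Ω → Set Bool, Measurable A ∧
    ∀ᵐ x ∂(law V μ₀ μ₁), ∀ i, limitActions μ₀ μ₁ τ G i x = A x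

/-- The probability `p^i_t = P(A^i_t = S)` that agent `i` is right at time `t`. -/
noncomputable def probCorrect (τ : TieRule Ω) (G : SimpleGraph V) [G.LocallyFinite] (i : V)
    (t : ℕ) : ℝ :=
  (law V μ₀ μ₁).real {x | action μ₀ μ₁ τ G t i x = x.1}

/-- `p(G) = p`: for every agent `i` the limit `lim_t P(A^i_t = S)` exists and equals `p`. -/
def LearningProbEq (τ : TieRule Ω) (G : SimpleGraph V) [G.LocallyFinite] (p : ℝ) : Prop :=
  ∀ i, Tendsto (probCorrect μ₀ μ₁ τ G i) atTop (𝓝 p)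

end Model

/-- The agents agree in the limit on every (finite or infinite) connected, undirected graph with
finite degrees. Such a graph is countable. -/
def AlwaysLimitAgreement {Ω : Type*} [MeasurableSpace Ω] (μ₀ μ₁ : Measure Ω)
    [IsProbabilityMeasure μ₀] [IsProbabilityMeasure μ₁] (τ : TieRule Ω) : Prop :=
  ∀ (W : Type) (H : SimpleGraph W) [H.LocallyFinite], H.Connected → LimitAgreement μ₀ μ₁ τ H

end BayesianLearning

namespace BayesianLearning

open ProbabilityTheory

/-! Regard `S` as a sign. The drift `E[S | H_t]` of agent `i` is a bounded martingale with a limit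
`M i`. By agreement there is a single decision `d` that every agent knows in the limit and that is
optimal for every agent: `sgn d * M i = |M i|`. Hence `value d = E[sgn d * S]` equals `E|M i|` for
every `i`, and `E|drift|` at time `t` increases to it in the limit without exceeding it. The task is
to show that the value is 1.

The behaviour up to time `t` depends only on the ball of radius `t + 1`, and rooted networks of
bounded degree are compact for local convergence (`exists_limit_network`, by ultralimits). The value
is a supremum of local quantities, so it is lower semicontinuous (`value_le_of_tendsto`) and attains
its minimum `r` at some network `H`. Moving the root of `H` to infinity gives a limit `H'`, again of
value `r`.

Signals far away are nearly independent of `d` given `S`, yet `d` must be at least as good as what a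
remote agent knows. This bounds the drift on `H'` (`ae_drift_bounds`). As the mean of the limiting
drift is 0 and the mean of its modulus is `r`, the bound is an equality, and the limiting drift on
`H'` has modulus at least `r / 2` (`ae_value_le_abs_limit`). Here `r > 0` because the signals are
informative.

So on `H'` no agent ends near indifference. At one late time, the actions of remote agents are
therefore all close to `d`; they are also nearly independent of `d` given `S`. Thus `d` is
independent of itself given `S`, that is, a function of `S`, and `r > 0` forces it to be correct
(`one_le_value`). The minimum of the value is then 1, and every network learns. -/

/-- The observations of an agent at time `t`, when its closed neighbourhood is enumerated by
`Fin D`: its own signal, its own past actions, and the past actions listed by label. -/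
abbrev Obs (Ω : Type*) (D t : ℕ) : Type _ := Ω × (Fin t → Bool) × (Fin D → Fin t → Bool)

/-- The map `nb` enumerates, for every vertex `j`, the closed neighbourhood of `j`. -/
def IsLabelling {V : Type*} {D : ℕ} (G : SimpleGraph V) (nb : V → Fin D → V) : Prop :=
  ∀ j, Set.range (nb j) = insert j (G.neighborSet j)

/-! ### Versions of beliefs and actions that are everywhere defined functions of the signals. -/

section Canonical

variable {V Ω : Type*} [MeasurableSpace Ω] {D : ℕ}

/-- The observations of agent `j` at time `t` as a function of the signals. -/
def obs (nb : V → Fin D → V) (t : ℕ) (A : Fin t → V → (V → Ω) → Bool) (j : V) (ω : V → Ω) :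
    Obs Ω D t :=
  (ω j, fun s => A s j ω, fun a s => A s (nb j a) ω)

/-- A set of labels that enumerates the neighbours of `j` without repetition. -/
noncomputable def labels (nb : V → Fin D → V) (j : V) : Finset (Fin D) :=
  open scoped Classical in
  Finset.univ.filter fun a => nb j a ≠ j ∧ ∀ b < a, nb j b ≠ nb j a

variable (μ₀ μ₁ : Measure Ω) [IsProbabilityMeasure μ₀] [IsProbabilityMeasure μ₁]

/-- The posterior law of the state given the observations. -/
noncomputable def posterior (nb : V → Fin D → V) (t : ℕ) (A : Fin t → V → (V → Ω) → Bool) (j : V) :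
    Kernel (Obs Ω D t) Bool :=
  condDistrib (Prod.fst : Sample V Ω → Bool) (fun x => obs nb t A j x.2) (law V μ₀ μ₁)

/-- A version of the belief which is an everywhere defined function of the observations. -/
noncomputable def canonicalBelief (nb : V → Fin D → V) (t : ℕ) (A : Fin t → V → (V → Ω) → Bool)
    (j : V) (ω : V → Ω) : ℝ :=
  (posterior μ₀ μ₁ nb t A j (obs nb t A j ω)).real {true}

/-- The decision taken on the basis of the observations `y` by an agent with belief `b`. -/
noncomputable def decision (τ : TieRule Ω) (t : ℕ) (L : Finset (Fin D)) (b : ℝ) (y : Obs Ω D t) :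
    Bool :=
  if b > 1 / 2 then true else if b < 1 / 2 then false
  else τ.choose t y.1 y.2.1 (L.val.map y.2.2)

/-- The actions as everywhere defined functions of the signals: a version of `action`. -/
noncomputable def canonicalAction (τ : TieRule Ω) (nb : V → Fin D → V) : ℕ → V → (V → Ω) → Bool
  | t => fun j ω => decision τ t (labels nb j)
      (canonicalBelief μ₀ μ₁ nb t (fun s : Fin t => canonicalAction τ nb s.1) j ω)
      (obs nb t (fun s : Fin t => canonicalAction τ nb s.1) j ω)
termination_by t => t
decreasing_by all_goals exact s.2

/-- The canonical belief of agent `j` at time `t`, given the canonical past actions. -/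
noncomputable def canBelief (τ : TieRule Ω) (nb : V → Fin D → V) (t : ℕ) (j : V) (ω : V → Ω) : ℝ :=
  canonicalBelief μ₀ μ₁ nb t (fun s : Fin t => canonicalAction μ₀ μ₁ τ nb s.1) j ω

theorem canonicalAction_eq (τ : TieRule Ω) (nb : V → Fin D → V) (t : ℕ) (j : V) (ω : V → Ω) :
    canonicalAction μ₀ μ₁ τ nb t j ω = decision τ t (labels nb j) (canBelief μ₀ μ₁ τ nb t j ω)
      (obs nb t (fun s : Fin t => canonicalAction μ₀ μ₁ τ nb s.1) j ω) := by
  rw [canonicalAction]; rfl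

theorem measurable_obs (nb : V → Fin D → V) (t : ℕ) (A : Fin t → V → (V → Ω) → Bool) (j : V)
    (hA : ∀ s k, Measurable (A s k)) : Measurable (obs nb t A j) := by
  unfold obs
  exact (measurable_pi_apply j).prodMk ((measurable_pi_iff.2 fun s => hA s j).prodMk
    (measurable_pi_iff.2 fun a => measurable_pi_iff.2 fun s => hA s _))

theorem measurable_canonicalBelief (nb : V → Fin D → V) (t : ℕ) (A : Fin t → V → (V → Ω) → Bool)
    (j : V) (hA : ∀ s k, Measurable (A s k)) : Measurable (canonicalBelief μ₀ μ₁ nb t A j) :=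
  ((Kernel.measurable_coe _ (MeasurableSet.singleton true)).comp
    (measurable_obs nb t A j hA)).ennreal_toReal

theorem measurable_decision (τ : TieRule Ω) (t : ℕ) (L : Finset (Fin D)) :
    Measurable (fun q : ℝ × Obs Ω D t => decision τ t L q.1 q.2) := by
  unfold decision
  have h : Measurable fun y : Obs Ω D t => τ.choose t y.1 y.2.1 (L.val.map y.2.2) :=
    measurable_from_prod_countable_left fun q => τ.measurable_choose t q.1 (L.val.map q.2)
  exact Measurable.ite (measurableSet_lt measurable_const measurable_fst) measurable_const
    (Measurable.ite (measurableSet_lt measurable_fst measurable_const) measurable_const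
      (h.comp measurable_snd))

theorem measurable_canonicalAction (τ : TieRule Ω) (nb : V → Fin D → V) (t : ℕ) (j : V) :
    Measurable (canonicalAction μ₀ μ₁ τ nb t j) := by
  induction t using Nat.strong_induction_on generalizing j with
  | _ t ih =>
    have h1 := measurable_canonicalBelief μ₀ μ₁ nb t
      (fun s : Fin t => canonicalAction μ₀ μ₁ τ nb s.1) j fun s k => ih s s.2 k
    have h2 := measurable_obs nb t
      (fun s : Fin t => canonicalAction μ₀ μ₁ τ nb s.1) j fun s k => ih s s.2 k
    rw [funext (canonicalAction_eq μ₀ μ₁ τ nb t j)]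
    exact (measurable_decision τ t (labels nb j)).comp (h1.prodMk h2)

theorem measurable_canBelief (τ : TieRule Ω) (nb : V → Fin D → V) (t : ℕ) (j : V) :
    Measurable (canBelief μ₀ μ₁ τ nb t j) :=
  measurable_canonicalBelief μ₀ μ₁ nb t _ j
    fun s k => measurable_canonicalAction μ₀ μ₁ τ nb s k

/-- The labelling may repeat vertices and includes `j` itself, whereas the tie-breaking rule sees
each neighbour exactly once. Keeping the least label of each neighbour restores the right multiset.
-/
theorem map_labels {G : SimpleGraph V} [G.LocallyFinite] {nb : V → Fin D → V}
    (hnb : IsLabelling G nb) (j : V) {β : Type*} (f : V → β) :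
    (labels nb j).val.map (fun a => f (nb j a)) = (G.neighborFinset j).val.map f := by
  classical
  refine Multiset.map_eq_map_of_bij_of_nodup _ _ (labels nb j).nodup (G.neighborFinset j).nodup
    (fun a _ => nb j a) ?_ ?_ ?_ fun _ _ => rfl
  · intro a ha
    have ha' : a ∈ labels nb j := ha
    simp only [labels, Finset.mem_filter] at ha'
    have : nb j a ∈ insert j (G.neighborSet j) := hnb j ▸ Set.mem_range_self a
    have h2 : nb j a ∈ G.neighborFinset j := by
      rw [SimpleGraph.mem_neighborFinset]
      exact this.resolve_left ha'.2.1
    exact h2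
  · intro a ha b hb hab
    have ha' : a ∈ labels nb j := ha
    have hb' : b ∈ labels nb j := hb
    simp only [labels, Finset.mem_filter] at ha' hb'
    rcases lt_trichotomy a b with h | h | h
    · exact absurd hab (hb'.2.2 a h)
    · exact h
    · exact absurd hab.symm (ha'.2.2 b h)
  · intro k hk
    have hk' : k ∈ G.neighborFinset j := hk
    rw [SimpleGraph.mem_neighborFinset] at hk'
    have hr : ∃ a, nb j a = k := by
      have : k ∈ Set.range (nb j) := by rw [hnb j]; exact Or.inr hk'
      exact this
    have hm := wellFounded_lt.min_mem {a : Fin D | nb j a = k} hr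
    refine ⟨wellFounded_lt.min {a : Fin D | nb j a = k} hr, ?_, hm⟩
    have h3 : wellFounded_lt.min {a : Fin D | nb j a = k} hr ∈ labels nb j := by
      simp only [labels, Finset.mem_filter, Finset.mem_univ, true_and]
      refine ⟨?_, fun b hb hbk => ?_⟩
      · rw [hm]; exact hk'.ne'
      · exact wellFounded_lt.not_lt_min {a : Fin D | nb j a = k} (hbk.trans hm) hb
    exact h3

theorem info_eq_comap {G : SimpleGraph V} {nb : V → Fin D → V} (hnb : IsLabelling G nb) (t : ℕ)
    (a : Fin t → V → Sample V Ω → Bool) (i : V) :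
    info G t a i = MeasurableSpace.comap
      (fun x => ((x.2 i, fun s => a s i x, fun b s => a s (nb i b) x) : Obs Ω D t))
      inferInstance := by
  apply le_antisymm
  · refine sup_le ?_ (iSup₂_le fun j hj => iSup_le fun s => ?_)
    · exact (measurable_fst.comp (comap_measurable
        (fun x => ((x.2 i, fun s => a s i x, fun b s => a s (nb i b) x) : Obs Ω D t)))).comap_le
    · rw [← hnb i] at hj
      obtain ⟨b, rfl⟩ := hj
      refine Measurable.comap_le ?_
      have h : Measurable fun y : Obs Ω D t => y.2.2 b s :=
        (measurable_pi_apply s).comp ((measurable_pi_apply b).comp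
          (measurable_snd.comp measurable_snd))
      exact h.comp (comap_measurable
        (fun x => ((x.2 i, fun s => a s i x, fun b s => a s (nb i b) x) : Obs Ω D t)))
  · refine Measurable.comap_le ?_
    have hact : ∀ s, ∀ j ∈ insert i (G.neighborSet i), Measurable[info G t a i] (a s j) :=
      fun s j hj => Measurable.of_comap_le (le_sup_of_le_right
        (le_iSup₂_of_le j hj (le_iSup (fun s : Fin t =>
          MeasurableSpace.comap (a s j) inferInstance) s)))
    refine Measurable.prodMk (Measurable.of_comap_le le_sup_left) (Measurable.prodMk ?_ ?_)
    · exact (@measurable_pi_iff _ _ _ (info G t a i) _ _).2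
        fun s => hact s i (Set.mem_insert _ _)
    · refine (@measurable_pi_iff _ _ _ (info G t a i) _ _).2 fun j =>
        (@measurable_pi_iff _ _ _ (info G t a i) _ _).2 fun s => hact s _ ?_
      rw [← hnb i]; exact Set.mem_range_self j

/-- The information is generated by one random variable, the labelled observations, so the
conditional expectation is a regular conditional law evaluated at them. That law does not change
when the past actions are altered on a null set. -/
theorem belief_ae_eq_canonicalBelief {G : SimpleGraph V} {nb : V → Fin D → V}
    (hnb : IsLabelling G nb) (t : ℕ) (a : Fin t → V → Sample V Ω → Bool)
    (A : Fin t → V → (V → Ω) → Bool) (ha : ∀ s j, Measurable (a s j))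
    (haA : ∀ s j, a s j =ᵐ[law V μ₀ μ₁] fun x => A s j x.2) (i : V) :
    belief μ₀ μ₁ G t a i =ᵐ[law V μ₀ μ₁] fun x => canonicalBelief μ₀ μ₁ nb t A i x.2 := by
  set Y : Sample V Ω → Obs Ω D t :=
    fun x => (x.2 i, fun s => a s i x, fun b s => a s (nb i b) x) with hY
  have hYm : Measurable Y :=
    ((measurable_pi_apply i).comp measurable_snd).prodMk
      ((measurable_pi_iff.2 fun s => ha s i).prodMk (measurable_pi_iff.2 fun b => measurable_pi_iff.2 fun s => ha s _))
  have hYeq : Y =ᵐ[law V μ₀ μ₁] fun x => obs nb t A i x.2 := by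
    have h1 : ∀ᵐ x ∂(law V μ₀ μ₁), ∀ s, a s i x = A s i x.2 := ae_all_iff.2 fun s => haA s i
    have h2 : ∀ᵐ x ∂(law V μ₀ μ₁), ∀ b s, a s (nb i b) x = A s (nb i b) x.2 :=
      ae_all_iff.2 fun b => ae_all_iff.2 fun s => haA s _
    filter_upwards [h1, h2] with x hx1 hx2
    simp only [hY, obs, hx1, hx2]
  have h := condDistrib_ae_eq_condExp (μ := law V μ₀ μ₁) hYm
    (measurable_fst : Measurable (Prod.fst : Sample V Ω → Bool)) (MeasurableSet.singleton true)
  have hd := condDistrib_congr (μ := law V μ₀ μ₁) (mβ := inferInstance)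
    (EventuallyEq.refl _ (Prod.fst : Sample V Ω → Bool)) hYeq
  rw [hd] at h
  unfold belief
  rw [info_eq_comap hnb t a i]
  filter_upwards [h, hYeq] with x hx1 hx2
  unfold canonicalBelief posterior
  rw [← hx2]
  exact hx1.symm

theorem action_ae_eq_canonicalAction (τ : TieRule Ω) {G : SimpleGraph V} [G.LocallyFinite]
    {nb : V → Fin D → V} (hnb : IsLabelling G nb) (t : ℕ) (i : V) :
    action μ₀ μ₁ τ G t i =ᵐ[law V μ₀ μ₁] fun x => canonicalAction μ₀ μ₁ τ nb t i x.2 := by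
  induction t using Nat.strong_induction_on generalizing i with
  | _ t ih =>
    have h := belief_ae_eq_canonicalBelief μ₀ μ₁ hnb t
      (fun s : Fin t => action μ₀ μ₁ τ G s.1) (fun s : Fin t => canonicalAction μ₀ μ₁ τ nb s.1)
      (fun s j => (measurable_action μ₀ μ₁ τ G s j).2) (fun s j => ih s s.2 j) i
    have h1 : ∀ᵐ x ∂(law V μ₀ μ₁), ∀ s : Fin t, action μ₀ μ₁ τ G s i x =
      canonicalAction μ₀ μ₁ τ nb s i x.2 := ae_all_iff.2 fun s => ih s s.2 i
    have h2 : ∀ᵐ x ∂(law V μ₀ μ₁), ∀ b, ∀ s : Fin t, action μ₀ μ₁ τ G s (nb i b) x =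
      canonicalAction μ₀ μ₁ τ nb s (nb i b) x.2 :=
      ae_all_iff.2 fun b => ae_all_iff.2 fun s => ih s s.2 _
    filter_upwards [h, h1, h2] with x hx hx1 hx2
    rw [canonicalAction_eq, action, myopicChoice, decision, hx]
    have e : (labels nb i).val.map (fun a (s : Fin t) => canonicalAction μ₀ μ₁ τ nb s (nb i a) x.2) =
        (G.neighborFinset i).val.map (fun j => fun s : Fin t => action μ₀ μ₁ τ G s j x) := by
      rw [← map_labels hnb i]
      refine Multiset.map_congr rfl fun a _ => funext fun s => (hx2 a s).symm
    simp only [obs, hx1, e]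
    rfl

theorem belief_ae_eq_canBelief (τ : TieRule Ω) {G : SimpleGraph V} [G.LocallyFinite]
    {nb : V → Fin D → V} (hnb : IsLabelling G nb) (t : ℕ) (i : V) :
    belief μ₀ μ₁ G t (fun s : Fin t => action μ₀ μ₁ τ G s.1) i =ᵐ[law V μ₀ μ₁]
      fun x => canBelief μ₀ μ₁ τ nb t i x.2 :=
  belief_ae_eq_canonicalBelief μ₀ μ₁ hnb t _ _ (fun s j => (measurable_action μ₀ μ₁ τ G s j).2)
    (fun s j => action_ae_eq_canonicalAction μ₀ μ₁ τ hnb s j) i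

end Canonical

/-! ### Locality: beliefs and actions up to a given time are determined by a ball. -/

section Transfer

variable {V V' Q Ω : Type*} [MeasurableSpace Ω] {D : ℕ}
variable (μ₀ μ₁ : Measure Ω) [IsProbabilityMeasure μ₀] [IsProbabilityMeasure μ₁]

theorem map_law_precomp {ι : Q → V} (hι : Function.Injective ι) :
    (law V μ₀ μ₁).map (fun x => (x.1, fun q => x.2 (ι q))) = law Q μ₀ μ₁ := by
  have hm : Measurable fun (ω : V → Ω) (q : Q) => ω (ι q) :=
    measurable_pi_iff.2 fun q => measurable_pi_apply _
  have h (b : Bool) (μ : Measure Ω) [IsProbabilityMeasure μ] :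
      ((Measure.dirac b).prod (Measure.infinitePi (fun _ : V => μ))).map
        (fun x => (x.1, fun q => x.2 (ι q))) =
      (Measure.dirac b).prod (Measure.infinitePi (fun _ : Q => μ)) := by
    have := Measure.map_prod_map (Measure.dirac b) (Measure.infinitePi (fun _ : V => μ))
      measurable_id hm
    rw [Measure.map_id, Measure.map_infinitePi_infinitePi_of_inj (P := fun _ => μ) hι] at this
    exact this.symm
  have hm' : Measurable fun x : Bool × (V → Ω) => (x.1, fun q => x.2 (ι q)) :=
    measurable_fst.prodMk (hm.comp measurable_snd)
  unfold law
  rw [Measure.map_add _ _ hm', Measure.map_smul, Measure.map_smul, h, h]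

/-- A function of the signals and a function of the signals on another vertex set that agree
whenever the signals agree on a common set of vertices have the same law, jointly with the
state. -/
theorem map_law_eq {β : Type*} [MeasurableSpace β] {ι : Q → V} {ι' : Q → V'}
    (hι : Function.Injective ι) (hι' : Function.Injective ι')
    {f : (V → Ω) → β} {f' : (V' → Ω) → β} (hf' : Measurable f')
    (h : ∀ ω ω', (∀ q, ω (ι q) = ω' (ι' q)) → f ω = f' ω') :
    (law V μ₀ μ₁).map (fun x => (x.1, f x.2)) = (law V' μ₀ μ₁).map (fun x => (x.1, f' x.2)) := by
  obtain ⟨w₀⟩ : Nonempty Ω := nonempty_of_isProbabilityMeasure μ₀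
  let ext : (Q → Ω) → V' → Ω := fun q => Function.extend ι' q fun _ => w₀
  have hext : Measurable ext := by
    refine measurable_pi_iff.2 fun v => ?_
    by_cases hv : ∃ q, ι' q = v
    · obtain ⟨q, rfl⟩ := hv
      simpa only [ext, hι'.extend_apply] using measurable_pi_apply q
    · simpa only [ext, Function.extend_apply' _ _ _ hv] using measurable_const
  have hfx (q : Q → Ω) (k : Q) : ext q (ι' k) = q k := hι'.extend_apply _ _ _
  have h1 (ω : V → Ω) : f ω = f' (ext fun q => ω (ι q)) := 
    h _ _ fun k => (hfx (fun q => ω (ι q)) k).symm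
  have h2 (ω' : V' → Ω) : f' ω' = f' (ext fun q => ω' (ι' q)) := by
    let ω : V → Ω := Function.extend ι (fun q => ω' (ι' q)) fun _ => w₀
    have hω (q : Q) : ω (ι q) = ω' (ι' q) := hι.extend_apply _ _ _
    rw [← h ω ω' hω, h1 ω]
    simp only [hω]
  have hg : Measurable fun x : Bool × (Q → Ω) => (x.1, f' (ext x.2)) :=
    measurable_fst.prodMk (hf'.comp (hext.comp measurable_snd))
  have hp {W : Type _} (κ : Q → W) :
      Measurable fun x : Bool × (W → Ω) => (x.1, fun q => x.2 (κ q)) :=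
    measurable_fst.prodMk (measurable_pi_iff.2 fun q => (measurable_pi_apply _).comp measurable_snd)
  have hV : (fun x : Sample V Ω => (x.1, f x.2)) =
      (fun x : Bool × (Q → Ω) => (x.1, f' (ext x.2))) ∘ fun x => (x.1, fun q => x.2 (ι q)) :=
    funext fun x => by simp only [Function.comp, ← h1]
  have hV' : (fun x : Sample V' Ω => (x.1, f' x.2)) =
      (fun x : Bool × (Q → Ω) => (x.1, f' (ext x.2))) ∘ fun x => (x.1, fun q => x.2 (ι' q)) :=
    funext fun x => by simp only [Function.comp, ← h2]
  have hp' : Measurable fun x : Bool × (V' → Ω) => (x.1, fun q => x.2 (ι' q)) :=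
    measurable_fst.prodMk (measurable_pi_iff.2 fun q => (measurable_pi_apply _).comp measurable_snd)
  rw [hV, hV', ← Measure.map_map hg (hp ι), ← Measure.map_map hg hp', map_law_precomp μ₀ μ₁ hι,
    map_law_precomp μ₀ μ₁ hι']

/-- The endpoint of the walk that starts at `i` and follows the labels of `w`. -/
def walk (nb : V → Fin D → V) (i : V) (w : List (Fin D)) : V := w.foldl nb i

theorem walk_append (nb : V → Fin D → V) (i : V) (w u : List (Fin D)) :
    walk nb i (w ++ u) = walk nb (walk nb i w) u := List.foldl_append

theorem walk_concat (nb : V → Fin D → V) (i : V) (w : List (Fin D)) (a : Fin D) :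
    walk nb i (w ++ [a]) = nb (walk nb i w) a := walk_append nb i w [a]

/-- The balls of radius `n` around `i` and `i'` look the same. -/
def SameBall (nb : V → Fin D → V) (i : V) (nb' : V' → Fin D → V') (i' : V') (n : ℕ) : Prop :=
  ∀ u u' : List (Fin D), u.length ≤ n → u'.length ≤ n →
    (walk nb i u = walk nb i u' ↔ walk nb' i' u = walk nb' i' u')

theorem SameBall.map_law_eq {nb : V → Fin D → V} {i : V} {nb' : V' → Fin D → V'} {i' : V'} {n : ℕ}
    (hs : SameBall nb i nb' i' n) {β : Type*} [MeasurableSpace β]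
    {f : (V → Ω) → β} {f' : (V' → Ω) → β} (hf' : Measurable f')
    (h : ∀ ω ω', (∀ u : List (Fin D), u.length ≤ n → ω (walk nb i u) = ω' (walk nb' i' u)) →
      f ω = f' ω') :
    (law V μ₀ μ₁).map (fun x => (x.1, f x.2)) = (law V' μ₀ μ₁).map (fun x => (x.1, f' x.2)) := by
  let K := {u : List (Fin D) // u.length ≤ n}
  let v : K → V := fun u => walk nb i u.1
  let v' : K → V' := fun u => walk nb' i' u.1
  have hv (u u' : K) : v u = v u' ↔ v' u = v' u' := hs _ _ u.2 u'.2
  -- One word is chosen for each vertex of the ball; equality of the patterns of coincidences makes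
  -- the vertices that these words reach in the other network distinct.
  let g : Set.range v → K := fun q => q.2.choose
  have hg (q : Set.range v) : v (g q) = q.1 := q.2.choose_spec
  refine BayesianLearning.map_law_eq (Q := Set.range v) (ι := Subtype.val) (ι' := fun q => v' (g q))
    μ₀ μ₁ Subtype.val_injective ?_ hf' ?_
  · intro q q' hqq
    have := (hv _ _).2 hqq
    rw [hg, hg] at this
    exact Subtype.ext this
  · intro ω ω' hω
    refine h ω ω' fun u hu => ?_
    have h1 := hω ⟨v ⟨u, hu⟩, Set.mem_range_self _⟩
    have h2 := (hv _ _).1 (hg ⟨v ⟨u, hu⟩, Set.mem_range_self _⟩)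
    simp only [h2] at h1
    exact h1

theorem SameBall.labels_eq {nb : V → Fin D → V} {i : V} {nb' : V' → Fin D → V'} {i' : V'} {n : ℕ}
    (hs : SameBall nb i nb' i' n) {w : List (Fin D)} (hw : w.length + 1 ≤ n) :
    labels nb (walk nb i w) = labels nb' (walk nb' i' w) := by
  ext a
  have hl (b : Fin D) : (w ++ [b]).length ≤ n := by simpa using hw
  have h1 (b b' : Fin D) : nb (walk nb i w) b = nb (walk nb i w) b' ↔
      nb' (walk nb' i' w) b = nb' (walk nb' i' w) b' := by
    simpa only [walk_concat] using hs (w ++ [b]) (w ++ [b']) (hl b) (hl b')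
  have h2 (b : Fin D) : nb (walk nb i w) b = walk nb i w ↔
      nb' (walk nb' i' w) b = walk nb' i' w := by
    simpa only [walk_concat] using hs (w ++ [b]) w (hl b) (by omega)
  simp only [labels, Finset.mem_filter, Finset.mem_univ, true_and, ne_eq, h1, h2]

/-- Induction on time: each step back in time costs one step along the graph, so `w.length + t`
never grows. The extra 1 is needed already at `t = 0`, because the tie-breaking rule uses the labels
at the end of `w`, which involve its neighbours. -/
theorem SameBall.canonical_eq (τ : TieRule Ω) {nb : V → Fin D → V} {i : V} {nb' : V' → Fin D → V'}
    {i' : V'} {n : ℕ} (hs : SameBall nb i nb' i' n) (t : ℕ) (w : List (Fin D))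
    (hw : w.length + t + 1 ≤ n) (ω : V → Ω) (ω' : V' → Ω)
    (hω : ∀ u : List (Fin D), u.length ≤ n → ω (walk nb i u) = ω' (walk nb' i' u)) :
    canBelief μ₀ μ₁ τ nb t (walk nb i w) ω = canBelief μ₀ μ₁ τ nb' t (walk nb' i' w) ω' ∧
    canonicalAction μ₀ μ₁ τ nb t (walk nb i w) ω =
      canonicalAction μ₀ μ₁ τ nb' t (walk nb' i' w) ω' := by
  induction t using Nat.strong_induction_on generalizing w ω ω' with
  | _ t ih =>
    -- Needed for arbitrary pairs of configurations, not only the given one, since the equality of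
    -- laws below uses all of them.
    have hobs (ω : V → Ω) (ω' : V' → Ω)
        (hω : ∀ u : List (Fin D), u.length ≤ n → ω (walk nb i u) = ω' (walk nb' i' u)) :
        obs nb t (fun s : Fin t => canonicalAction μ₀ μ₁ τ nb s.1) (walk nb i w) ω =
        obs nb' t (fun s : Fin t => canonicalAction μ₀ μ₁ τ nb' s.1) (walk nb' i' w) ω' := by
      unfold obs
      refine Prod.ext (hω w (by omega)) (Prod.ext (funext fun s => ?_)
        (funext fun a => funext fun s => ?_))
      · have := s.2
        exact (ih s s.2 w (by omega) ω ω' hω).2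
      · have := s.2
        have h := (ih s s.2 (w ++ [a]) (by simp; omega) ω ω' hω).2
        simpa only [walk_concat] using h
    have hpost : posterior μ₀ μ₁ nb t (fun s : Fin t => canonicalAction μ₀ μ₁ τ nb s.1)
        (walk nb i w) = posterior μ₀ μ₁ nb' t (fun s : Fin t => canonicalAction μ₀ μ₁ τ nb' s.1)
        (walk nb' i' w) := by
      have hm := hs.map_law_eq μ₀ μ₁ (measurable_obs nb' t
        (fun s : Fin t => canonicalAction μ₀ μ₁ τ nb' s.1) (walk nb' i' w)
        fun s k => measurable_canonicalAction μ₀ μ₁ τ nb' s k) hobs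
      have hm' := congrArg (Measure.map Prod.swap) hm
      have hmo {W : Type _} (nb : W → Fin D → W) (j : W) : Measurable fun x : Sample W Ω => (x.1,
          obs nb t (fun s : Fin t => canonicalAction μ₀ μ₁ τ nb s.1) j x.2) :=
        measurable_fst.prodMk ((measurable_obs nb t _ _
          fun s k => measurable_canonicalAction μ₀ μ₁ τ nb s k).comp measurable_snd)
      have hmo' : Measurable fun x : Sample V' Ω => (x.1,
          obs nb' t (fun s : Fin t => canonicalAction μ₀ μ₁ τ nb' s.1) (walk nb' i' w) x.2) :=
        measurable_fst.prodMk ((measurable_obs nb' t _ _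
          fun s k => measurable_canonicalAction μ₀ μ₁ τ nb' s k).comp measurable_snd)
      rw [Measure.map_map measurable_swap (hmo nb _),
        Measure.map_map measurable_swap hmo'] at hm'
      -- The posterior kernel is a function of the joint law of state and observations alone, so
      -- equal laws give kernels that are equal everywhere and not merely almost everywhere.
      unfold posterior
      rw [condDistrib, condDistrib]
      congr 1
    have hb : canBelief μ₀ μ₁ τ nb t (walk nb i w) ω =
        canBelief μ₀ μ₁ τ nb' t (walk nb' i' w) ω' := by
      unfold canBelief canonicalBelief
      rw [hpost, hobs ω ω' hω]
    refine ⟨hb, ?_⟩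
    rw [canonicalAction_eq, canonicalAction_eq, hb, hobs ω ω' hω, hs.labels_eq (by omega)]

theorem SameBall.refl (nb : V → Fin D → V) (i : V) (n : ℕ) : SameBall nb i nb i n :=
  fun _ _ _ _ => Iff.rfl

/-- The belief and the action of `i` at time `t` depend on the signals within distance `t + 1`. -/
theorem canonical_local (τ : TieRule Ω) (nb : V → Fin D → V) (i : V) (t : ℕ) (ω ω' : V → Ω)
    (hω : ∀ u : List (Fin D), u.length ≤ t + 1 → ω (walk nb i u) = ω' (walk nb i u)) :
    canBelief μ₀ μ₁ τ nb t i ω = canBelief μ₀ μ₁ τ nb t i ω' ∧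
    canonicalAction μ₀ μ₁ τ nb t i ω = canonicalAction μ₀ μ₁ τ nb t i ω' :=
  (SameBall.refl nb i (t + 1)).canonical_eq μ₀ μ₁ τ t [] (by simp) ω ω' hω

/-- If the balls of radius `t + 1` look the same, then the belief and the action at time `t` have
the same joint law with the state. -/
theorem SameBall.map_law_canonical (τ : TieRule Ω) {nb : V → Fin D → V} {i : V}
    {nb' : V' → Fin D → V'} {i' : V'} {t : ℕ} (hs : SameBall nb i nb' i' (t + 1)) :
    (law V μ₀ μ₁).map (fun x => (x.1, canBelief μ₀ μ₁ τ nb t i x.2,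
      canonicalAction μ₀ μ₁ τ nb t i x.2)) =
    (law V' μ₀ μ₁).map (fun x => (x.1, canBelief μ₀ μ₁ τ nb' t i' x.2,
      canonicalAction μ₀ μ₁ τ nb' t i' x.2)) :=
  hs.map_law_eq μ₀ μ₁ (f := fun ω => (canBelief μ₀ μ₁ τ nb t i ω,
      canonicalAction μ₀ μ₁ τ nb t i ω)) (f' := fun ω => (canBelief μ₀ μ₁ τ nb' t i' ω,
      canonicalAction μ₀ μ₁ τ nb' t i' ω)) ((measurable_canBelief μ₀ μ₁ τ nb' t i').prodMk
      (measurable_canonicalAction μ₀ μ₁ τ nb' t i'))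
    fun ω ω' hω => Prod.ext (hs.canonical_eq μ₀ μ₁ τ t [] (by simp) ω ω' hω).1
      (hs.canonical_eq μ₀ μ₁ τ t [] (by simp) ω ω' hω).2

end Transfer

/-! ### Signs, and asymptotic independence of remote signals given the state. -/

/-- The sign `±1` of a state or of an action. -/
def sgn (b : Bool) : ℝ := if b then 1 else -1

theorem abs_sgn (b : Bool) : |sgn b| = 1 := by cases b <;> simp [sgn]

theorem measurable_sgn : Measurable sgn := measurable_from_top

section StateInd

variable {V Ω : Type*}

/-- The indicator function of the event `S = b`. -/
def stateInd (b : Bool) (x : Sample V Ω) : ℝ := if x.1 = b then 1 else 0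

theorem abs_stateInd_le (b : Bool) (x : Sample V Ω) : |stateInd b x| ≤ 1 := by
  unfold stateInd; split_ifs <;> simp

theorem sgn_eq_stateInd (x : Sample V Ω) : sgn x.1 = stateInd true x - stateInd false x := by
  obtain ⟨b, ω⟩ := x
  cases b <;> simp [sgn, stateInd]

theorem stateInd_add (x : Sample V Ω) : stateInd true x + stateInd false x = 1 := by
  obtain ⟨b, ω⟩ := x
  cases b <;> simp [stateInd]

end StateInd

section Independence

variable {V Ω : Type*} [MeasurableSpace Ω] {D : ℕ}

theorem measurable_stateInd (b : Bool) : Measurable (stateInd b : Sample V Ω → ℝ) := by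
  have h : Measurable (fun c : Bool => if c = b then (1 : ℝ) else 0) := measurable_from_top
  exact h.comp measurable_fst

variable (μ₀ μ₁ : Measure Ω) [IsProbabilityMeasure μ₀] [IsProbabilityMeasure μ₁]

theorem integrable_of_abs_le {α : Type*} {_ : MeasurableSpace α} {μ : Measure α} [IsFiniteMeasure μ]
    {f : α → ℝ} (hf : Measurable f) {C : ℝ} (h : ∀ x, |f x| ≤ C) : Integrable f μ :=
  Integrable.of_bound hf.aestronglyMeasurable C (ae_of_all _ h)

variable (V) in
/-- The law of the signals when the state is `b`. -/
noncomputable def signalLaw : Bool → Measure (V → Ω)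
  | false => Measure.infinitePi fun _ => μ₀
  | true => Measure.infinitePi fun _ => μ₁

instance (b : Bool) : IsProbabilityMeasure (signalLaw V μ₀ μ₁ b) := by
  cases b <;> unfold signalLaw <;> infer_instance

theorem integral_law {f : Sample V Ω → ℝ} (hf : Measurable f) {C : ℝ} (hC : ∀ x, |f x| ≤ C) :
    ∫ x, f x ∂(law V μ₀ μ₁) = 2⁻¹ * ∫ ω, f (false, ω) ∂(signalLaw V μ₀ μ₁ false) +
      2⁻¹ * ∫ ω, f (true, ω) ∂(signalLaw V μ₀ μ₁ true) := by
  unfold law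
  rw [Measure.dirac_prod, Measure.dirac_prod, integral_add_measure, integral_smul_measure,
    integral_smul_measure, integral_map measurable_prodMk_left.aemeasurable
      hf.aestronglyMeasurable, integral_map measurable_prodMk_left.aemeasurable
      hf.aestronglyMeasurable]
  · simp [signalLaw]
  · have := Measure.isProbabilityMeasure_map (μ := Measure.infinitePi fun _ : V => μ₀)
      (measurable_prodMk_left (x := false)).aemeasurable
    exact (integrable_of_abs_le hf hC).smul_measure (by simp)
  · have := Measure.isProbabilityMeasure_map (μ := Measure.infinitePi fun _ : V => μ₁)
      (measurable_prodMk_left (x := true)).aemeasurable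
    exact (integrable_of_abs_le hf hC).smul_measure (by simp)

theorem integral_mul_stateInd {f : (V → Ω) → ℝ} (hf : Measurable f) {C : ℝ} (hC : ∀ x, |f x| ≤ C)
    (b : Bool) :
    ∫ x, f x.2 * stateInd b x ∂(law V μ₀ μ₁) = 2⁻¹ * ∫ ω, f ω ∂(signalLaw V μ₀ μ₁ b) := by
  rw [integral_law μ₀ μ₁ (f := fun x => f x.2 * stateInd b x) (C := C)
    ((hf.comp measurable_snd).mul (measurable_stateInd b))]
  · cases b <;> simp [stateInd]
  · intro x
    rw [abs_mul]
    calc _ ≤ C * 1 := mul_le_mul (hC _) (abs_stateInd_le _ _) (abs_nonneg _)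
          ((abs_nonneg _).trans (hC x.2))
      _ = C := mul_one C

theorem integral_stateInd (b : Bool) :
    ∫ x, stateInd b x ∂(law V μ₀ μ₁) = 2⁻¹ := by
  simpa using integral_mul_stateInd (V := V) μ₀ μ₁ (f := fun _ => 1) measurable_const (C := 1)
    (by simp) b

theorem exists_comp_restrict [Nonempty Ω] {f : (V → Ω) → ℝ} (hf : Measurable f) {F : Finset V}
    (hF : DependsOn f (F : Set V)) :
    ∃ g : (F → Ω) → ℝ, Measurable g ∧ f = fun ω => g (fun v => ω v) := by
  classical
  let w₀ : Ω := Classical.arbitrary Ω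
  let ext : (F → Ω) → V → Ω := fun q v => if h : v ∈ F then q ⟨v, h⟩ else w₀
  have hext : Measurable ext := by
    refine measurable_pi_iff.2 fun v => ?_
    by_cases hv : v ∈ F
    · simpa only [ext, hv, dite_true] using measurable_pi_apply _
    · simpa only [ext, hv, dite_false] using measurable_const
  refine ⟨f ∘ ext, hf.comp hext, funext fun ω => hF fun v hv => ?_⟩
  have hv' : v ∈ F := hv
  simp [ext, hv']

theorem integral_mul_of_disjoint {f g : (V → Ω) → ℝ} (hf : Measurable f) (hg : Measurable g)
    {F F' : Finset V} (hF : DependsOn f (F : Set V)) (hF' : DependsOn g (F' : Set V))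
    (hd : Disjoint F F') (b : Bool) :
    ∫ ω, f ω * g ω ∂(signalLaw V μ₀ μ₁ b) =
      (∫ ω, f ω ∂(signalLaw V μ₀ μ₁ b)) * ∫ ω, g ω ∂(signalLaw V μ₀ μ₁ b) := by
  have : Nonempty Ω := nonempty_of_isProbabilityMeasure μ₀
  have hi : iIndepFun (fun (v : V) (ω : V → Ω) => ω v) (signalLaw V μ₀ μ₁ b) := by
    cases b
    · exact iIndepFun_infinitePi (X := fun _ ω => ω) (fun _ => measurable_id)
    · exact iIndepFun_infinitePi (X := fun _ ω => ω) (fun _ => measurable_id)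
  obtain ⟨f', hf', hff⟩ := exists_comp_restrict hf hF
  obtain ⟨g', hg', hgg⟩ := exists_comp_restrict hg hF'
  have h := (hi.indepFun_finset F F' hd fun v => measurable_pi_apply v).comp hf' hg'
  have h' : IndepFun f g (signalLaw V μ₀ μ₁ b) := by rw [hff, hgg]; exact h
  exact h'.integral_mul_eq_mul_integral hf.aestronglyMeasurable hg.aestronglyMeasurable

/-- Cylinders form a ring that generates the product σ-algebra, so every event is approximated in
measure by one that depends on finitely many signals. Signs differ by 2 on the symmetric difference,
whence the `ε / 2`. -/
theorem exists_approx_dependsOn {d : (V → Ω) → Bool} (hd : Measurable d) {ε : ℝ} (hε : 0 < ε) :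
    ∃ (d' : (V → Ω) → Bool) (F : Finset V), Measurable d' ∧ DependsOn d' (F : Set V) ∧
      ∫ x, |sgn (d x.2) - sgn (d' x.2)| ∂(law V μ₀ μ₁) ≤ ε := by
  classical
  set ν := (law V μ₀ μ₁).map Prod.snd with hν
  have : IsProbabilityMeasure ν := Measure.isProbabilityMeasure_map measurable_snd.aemeasurable
  have hE : MeasurableSet (d ⁻¹' {true}) := hd (MeasurableSet.singleton _)
  obtain ⟨C, hC, hCE⟩ := exists_measure_symmDiff_lt_of_generateFrom_isSetRing (μ := ν)
    isSetRing_measurableCylinders ⟨{Set.univ}, Set.countable_singleton _, by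
      rintro _ rfl; exact univ_mem_measurableCylinders _, by simp⟩
    generateFrom_measurableCylinders.symm hE
    (ε := ENNReal.ofReal (ε / 2)) (by simpa using hε)
  have hCm : MeasurableSet C := MeasurableSet.of_mem_measurableCylinders hC
  obtain ⟨F, S, hS, rfl⟩ := (mem_measurableCylinders C).1 hC
  have hdm : Measurable fun ω : V → Ω => if ω ∈ cylinder F S then true else false :=
    Measurable.ite (show MeasurableSet {ω : V → Ω | ω ∈ cylinder F S} from hCm) measurable_const
      measurable_const
  refine ⟨fun ω => if ω ∈ cylinder F S then true else false, F,
    hdm, ?_, ?_⟩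
  · intro ω ω' h
    have : F.restrict ω = F.restrict ω' := funext fun v => h v v.2
    simp only [mem_cylinder, this]
  · set Δ := symmDiff (cylinder F S) (d ⁻¹' {true}) with hΔ
    have hΔm : MeasurableSet Δ := hCm.symmDiff hE
    have hpt (x : Sample V Ω) : |sgn (d x.2) - sgn (if x.2 ∈ cylinder F S then true else false)| =
        (Prod.snd ⁻¹' Δ).indicator (fun _ => (2 : ℝ)) x := by
      by_cases h1 : x.2 ∈ cylinder F S <;> cases h2 : d x.2 <;>
        simp [h1, h2, hΔ, Set.mem_symmDiff, sgn, Set.indicator] <;> norm_num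
    simp only [hpt]
    rw [integral_indicator (measurable_snd hΔm), setIntegral_const]
    have h3 : ν Δ = law V μ₀ μ₁ (Prod.snd ⁻¹' Δ) := Measure.map_apply measurable_snd hΔm
    have h4 : (law V μ₀ μ₁).real (Prod.snd ⁻¹' Δ) ≤ ε / 2 := by
      rw [Measure.real, ← h3]
      exact ENNReal.toReal_le_of_le_ofReal (by positivity) hCE.le
    simp only [smul_eq_mul]
    linarith

theorem exists_walk_reverse {G : SimpleGraph V} {nb : V → Fin D → V} (hnb : IsLabelling G nb)
    (u : List (Fin D)) : ∀ v, ∃ u' : List (Fin D), u'.length = u.length ∧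
      walk nb (walk nb v u) u' = v := by
  induction u with
  | nil => exact fun v => ⟨[], rfl, rfl⟩
  | cons a u ih =>
    intro v
    obtain ⟨u', hu', h⟩ := ih (nb v a)
    obtain ⟨b, hb⟩ : v ∈ Set.range (nb (nb v a)) := by
      have : nb v a ∈ insert v (G.neighborSet v) := hnb v ▸ Set.mem_range_self a
      rw [hnb]
      rcases this with h | h
      · exact Or.inl h.symm
      · exact Or.inr (SimpleGraph.Adj.symm h)
    refine ⟨u' ++ [b], by simp [hu'], ?_⟩
    rw [walk_concat]
    change nb (walk nb (walk nb (nb v a) u) u') b = v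
    rw [h, hb]

theorem finite_words (D n : ℕ) : {u : List (Fin D) | u.length ≤ n}.Finite :=
  List.finite_length_le (Fin D) n

/-- The ball of radius `n` around `i`. -/
noncomputable def ball (nb : V → Fin D → V) (i : V) (n : ℕ) : Finset V :=
  ((finite_words D n).image (walk nb i)).toFinset

theorem mem_ball {nb : V → Fin D → V} {i : V} {n : ℕ} {v : V} :
    v ∈ ball nb i n ↔ ∃ u : List (Fin D), u.length ≤ n ∧ walk nb i u = v := by
  simp [ball]

/-- Walks can be reversed, so a ball that meets `F` has its centre within distance `n` of `F`, which
leaves finitely many centres. -/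
theorem eventually_disjoint_ball {G : SimpleGraph V} {nb : V → Fin D → V} (hnb : IsLabelling G nb)
    {U : Filter ℕ} {k : ℕ → V} (hk : Tendsto k U cofinite) (F : Finset V) (n : ℕ) :
    ∀ᶠ m in U, Disjoint (ball nb (k m) n) F := by
  classical
  have h := hk.eventually (Finset.eventually_cofinite_notMem (F.biUnion fun v => ball nb v n))
  filter_upwards [h] with m hm
  rw [Finset.disjoint_left]
  intro v hv hvF
  obtain ⟨u, hu, rfl⟩ := mem_ball.1 hv
  obtain ⟨u', hu', h⟩ := exists_walk_reverse hnb u (k m)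
  exact hm (Finset.mem_biUnion.2 ⟨_, hvF, mem_ball.2 ⟨u', hu'.trans_le hu, h⟩⟩)

/-- Conditioned on the state, quantities that depend on the signals in a ball whose centre tends to
infinity are asymptotically independent of every event. -/
theorem tendsto_asymptotic_independence {G : SimpleGraph V} {nb : V → Fin D → V}
    (hnb : IsLabelling G nb) {U : Filter ℕ} {k : ℕ → V} (hk : Tendsto k U cofinite)
    {f : ℕ → (V → Ω) → ℝ} (hf : ∀ m, Measurable (f m)) (hf1 : ∀ m ω, |f m ω| ≤ 1) (n : ℕ)
    (hloc : ∀ m ω ω', (∀ u : List (Fin D), u.length ≤ n →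
      ω (walk nb (k m) u) = ω' (walk nb (k m) u)) → f m ω = f m ω')
    {d : (V → Ω) → Bool} (hd : Measurable d) (b : Bool) :
    Tendsto (fun m => ∫ x, f m x.2 * sgn (d x.2) * stateInd b x ∂(law V μ₀ μ₁) -
      2 * (∫ x, f m x.2 * stateInd b x ∂(law V μ₀ μ₁)) *
        ∫ x, sgn (d x.2) * stateInd b x ∂(law V μ₀ μ₁)) U (𝓝 0) := by
  rw [Metric.tendsto_nhds]
  intro ε hε
  obtain ⟨d', F, hd', hF, hdd⟩ := exists_approx_dependsOn μ₀ μ₁ hd (show 0 < ε / 3 by positivity)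
  filter_upwards [eventually_disjoint_ball hnb hk F n] with m hm
  rw [Real.dist_eq, sub_zero]
  have hsd : Measurable fun ω => sgn (d ω) := measurable_sgn.comp hd
  have hsd' : Measurable fun ω => sgn (d' ω) := measurable_sgn.comp hd'
  have hi {h : (V → Ω) → ℝ} (hh : Measurable h) (h1 : ∀ ω, |h ω| ≤ 1) :
      Integrable (fun x => h x.2 * stateInd b x) (law V μ₀ μ₁) :=
    integrable_of_abs_le ((hh.comp measurable_snd).mul (measurable_stateInd b)) (C := 1) fun x => by
      rw [abs_mul]; exact mul_le_one₀ (h1 _) (abs_nonneg _) (abs_stateInd_le _ _)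
  have hdi : Integrable (fun x : Sample V Ω => |sgn (d x.2) - sgn (d' x.2)|) (law V μ₀ μ₁) :=
    integrable_of_abs_le (((hsd.sub hsd').comp measurable_snd).abs) (C := 2) fun x => by
      rw [abs_abs]
      exact (abs_sub _ _).trans (by rw [abs_sgn, abs_sgn]; norm_num)
  have hclose {h : (V → Ω) → ℝ} (hh : Measurable h) (h1 : ∀ ω, |h ω| ≤ 1) :
      |∫ x, h x.2 * sgn (d x.2) * stateInd b x ∂(law V μ₀ μ₁) -
        ∫ x, h x.2 * sgn (d' x.2) * stateInd b x ∂(law V μ₀ μ₁)| ≤ ε / 3 := by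
    have hb (e : (V → Ω) → Bool) (ω : V → Ω) : |h ω * sgn (e ω)| ≤ 1 := by
      rw [abs_mul, abs_sgn, mul_one]; exact h1 ω
    rw [← integral_sub (hi (h := fun ω => h ω * sgn (d ω)) (hh.mul hsd) (hb d))
      (hi (h := fun ω => h ω * sgn (d' ω)) (hh.mul hsd') (hb d'))]
    refine (abs_integral_le_integral_abs).trans (le_trans (integral_mono_of_nonneg
      (ae_of_all _ fun x => abs_nonneg _) hdi (ae_of_all _ fun x => ?_)) hdd)
    have : h x.2 * sgn (d x.2) * stateInd b x - h x.2 * sgn (d' x.2) * stateInd b x =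
      (h x.2 * stateInd b x) * (sgn (d x.2) - sgn (d' x.2)) := by ring
    simp only [this, abs_mul]
    exact mul_le_of_le_one_left (abs_nonneg _)
      (mul_le_one₀ (h1 _) (abs_nonneg _) (abs_stateInd_le _ _))
  have hball : DependsOn (f m) (ball nb (k m) n : Set V) := fun ω ω' h =>
    hloc m ω ω' fun u hu => h _ (mem_ball.2 ⟨u, hu, rfl⟩)
  have hF2 : DependsOn (fun ω => sgn (d' ω)) (F : Set V) := fun ω ω' h => congrArg sgn (hF h)
  -- Each integral restricted to `S = b` is half a conditional mean; the factor 2 compensates for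
  -- the product of two halves.
  have hind : ∫ x, f m x.2 * sgn (d' x.2) * stateInd b x ∂(law V μ₀ μ₁) =
      2 * (∫ x, f m x.2 * stateInd b x ∂(law V μ₀ μ₁)) *
        ∫ x, sgn (d' x.2) * stateInd b x ∂(law V μ₀ μ₁) := by
    rw [integral_mul_stateInd μ₀ μ₁ (hf m) (hf1 m) b,
      integral_mul_stateInd μ₀ μ₁ hsd' (fun ω => (abs_sgn _).le) b,
      integral_mul_stateInd μ₀ μ₁ (f := fun ω => f m ω * sgn (d' ω)) ((hf m).mul hsd') (C := 1)
        (fun ω => by rw [abs_mul, abs_sgn, mul_one]; exact hf1 m ω) b,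
      integral_mul_of_disjoint μ₀ μ₁ (hf m) hsd' hball hF2 hm b]
    ring
  have hA := hclose (hf m) (hf1 m)
  have hB := hclose (h := fun _ => 1) measurable_const (by simp)
  simp only [one_mul] at hB
  have hfm : |∫ x, f m x.2 * stateInd b x ∂(law V μ₀ μ₁)| ≤ 2⁻¹ := by
    rw [integral_mul_stateInd μ₀ μ₁ (hf m) (hf1 m) b, abs_mul,
      abs_of_pos (by norm_num : (0:ℝ) < 2⁻¹)]
    refine mul_le_of_le_one_right (by norm_num) (abs_integral_le_integral_abs.trans ?_)
    refine (integral_mono_of_nonneg (ae_of_all _ fun _ => abs_nonneg _) (integrable_const 1)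
      (ae_of_all _ (hf1 m))).trans (by simp)
  set I := ∫ x, f m x.2 * stateInd b x ∂(law V μ₀ μ₁)
  set X := ∫ x, f m x.2 * sgn (d x.2) * stateInd b x ∂(law V μ₀ μ₁)
  set X' := ∫ x, f m x.2 * sgn (d' x.2) * stateInd b x ∂(law V μ₀ μ₁)
  set Y := ∫ x, sgn (d x.2) * stateInd b x ∂(law V μ₀ μ₁)
  set Y' := ∫ x, sgn (d' x.2) * stateInd b x ∂(law V μ₀ μ₁)
  have e : X - 2 * I * Y = (X - X') - 2 * I * (Y - Y') := by rw [hind]; ring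
  have h2 : |2 * I * (Y - Y')| ≤ ε / 3 := by
    rw [abs_mul, abs_mul, abs_two]
    have : 2 * |I| ≤ 1 := by linarith
    exact (mul_le_of_le_one_left (abs_nonneg _) this).trans hB
  rw [e]
  have := abs_sub (X - X') (2 * I * (Y - Y'))
  linarith

end Independence

/-! ### Convergence of the beliefs and the common limit decision. -/

theorem integral_mul_condExp {α : Type*} {m m0 : MeasurableSpace α} {μ : Measure α}
    [IsFiniteMeasure μ] (hm : m ≤ m0) {H g : α → ℝ} (hH : Measurable[m] H) {C : ℝ}
    (hC : ∀ x, |H x| ≤ C) (hg : Integrable g μ) :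
    ∫ x, H x * g x ∂μ = ∫ x, H x * (μ[g|m]) x ∂μ := by
  have hHg : Integrable (H * g) μ :=
    hg.bdd_mul (hH.mono hm le_rfl).aestronglyMeasurable (ae_of_all _ hC)
  have h := condExp_mul_of_stronglyMeasurable_left (μ := μ) hH.stronglyMeasurable hHg hg
  calc ∫ x, H x * g x ∂μ = ∫ x, (μ[H * g|m]) x ∂μ := (integral_condExp hm).symm
    _ = _ := integral_congr_ae h

section Limit

variable {V Ω : Type*} [MeasurableSpace Ω] {D : ℕ}
variable (μ₀ μ₁ : Measure Ω) [IsProbabilityMeasure μ₀] [IsProbabilityMeasure μ₁]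

theorem mem_limitActions {τ : TieRule Ω} {G : SimpleGraph V} [G.LocallyFinite] {i : V}
    {x : Sample V Ω} {b : Bool} :
    b ∈ limitActions μ₀ μ₁ τ G i x ↔ ∃ᶠ t in atTop, action μ₀ μ₁ τ G t i x = b := by
  change MapClusterPt b atTop _ ↔ _
  rw [mapClusterPt_iff_frequently]
  refine ⟨fun h => (h {b} (by simp)).mono fun t ht => ht, fun h s hs => h.mono fun t ht => ?_⟩
  rw [ht]; exact mem_of_mem_nhds hs

theorem limitActions_eq_singleton {τ : TieRule Ω} {G : SimpleGraph V} [G.LocallyFinite] {i : V}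
    {x : Sample V Ω} {b : Bool} :
    limitActions μ₀ μ₁ τ G i x = {b} ↔ ∀ᶠ t in atTop, action μ₀ μ₁ τ G t i x = b := by
  constructor
  · intro h
    have hb : (!b) ∉ limitActions μ₀ μ₁ τ G i x := by rw [h]; simp
    rw [mem_limitActions, not_frequently] at hb
    exact hb.mono fun t ht => by simpa using ht
  · intro h
    ext c
    rw [mem_limitActions, Set.mem_singleton_iff]
    constructor
    · intro hc
      obtain ⟨t, ht, ht'⟩ := (hc.and_eventually h).exists
      exact ht.symm.trans ht'
    · rintro rfl
      exact h.frequently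

theorem canBelief_mem_Icc (τ : TieRule Ω) (nb : V → Fin D → V) (t : ℕ) (i : V) (ω : V → Ω) :
    0 ≤ canBelief μ₀ μ₁ τ nb t i ω ∧ canBelief μ₀ μ₁ τ nb t i ω ≤ 1 := by
  unfold canBelief canonicalBelief posterior
  exact ⟨measureReal_nonneg, measureReal_le_one⟩

/-- The drift `2 P(S = 1 | H^i_t) - 1` of the belief, as a function of the sample. -/
noncomputable def drift (τ : TieRule Ω) (nb : V → Fin D → V) (t : ℕ) (i : V) (x : Sample V Ω) : ℝ :=
  2 * canBelief μ₀ μ₁ τ nb t i x.2 - 1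

theorem measurable_drift (τ : TieRule Ω) (nb : V → Fin D → V) (t : ℕ) (i : V) :
    Measurable (drift μ₀ μ₁ τ nb t i) :=
  (((measurable_canBelief μ₀ μ₁ τ nb t i).comp measurable_snd).const_mul 2).sub_const 1

theorem abs_drift_le (τ : TieRule Ω) (nb : V → Fin D → V) (t : ℕ) (i : V) (x : Sample V Ω) :
    |drift μ₀ μ₁ τ nb t i x| ≤ 1 := by
  have := canBelief_mem_Icc μ₀ μ₁ τ nb t i x.2
  rw [abs_le, drift]
  constructor <;> linarith [this.1, this.2]

theorem sgn_mul_drift (τ : TieRule Ω) (nb : V → Fin D → V) (t : ℕ) (i : V) (x : Sample V Ω) :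
    sgn (canonicalAction μ₀ μ₁ τ nb t i x.2) * drift μ₀ μ₁ τ nb t i x =
      |drift μ₀ μ₁ τ nb t i x| := by
  rw [canonicalAction_eq, decision, drift]
  set b := canBelief μ₀ μ₁ τ nb t i x.2
  split_ifs with h1 h2
  · rw [abs_of_nonneg (by linarith)]; simp [sgn]
  · rw [abs_of_neg (by linarith)]; simp [sgn]
  · rw [show 2 * b - 1 = 0 by linarith]; simp

/-- The observations of agent `i` as a filtration. -/
noncomputable def infoFiltration (τ : TieRule Ω) (G : SimpleGraph V) [G.LocallyFinite] (i : V) :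
    Filtration ℕ (inferInstance : MeasurableSpace (Sample V Ω)) where
  seq t := info G t (fun s : Fin t => action μ₀ μ₁ τ G s.1) i
  mono' := by
    intro s t hst
    refine sup_le_sup le_rfl (iSup₂_mono fun j _ => iSup_le fun r => ?_)
    exact le_iSup (fun r : Fin t => MeasurableSpace.comap (action μ₀ μ₁ τ G r.1 j) inferInstance)
      ⟨r.1, r.2.trans_le hst⟩
  le' t := info_le G t _ i fun s j => (measurable_action μ₀ μ₁ τ G s j).2

theorem integrable_sgn_state : Integrable (fun x : Sample V Ω => sgn x.1) (law V μ₀ μ₁) :=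
  integrable_of_abs_le (measurable_sgn.comp measurable_fst) (C := 1) fun _ => (abs_sgn _).le

theorem condExp_sgn_ae_eq_drift (τ : TieRule Ω) {G : SimpleGraph V} [G.LocallyFinite]
    {nb : V → Fin D → V} (hnb : IsLabelling G nb) (t : ℕ) (i : V) :
    (law V μ₀ μ₁)[fun x : Sample V Ω => sgn x.1 | infoFiltration μ₀ μ₁ τ G i t]
      =ᵐ[law V μ₀ μ₁] drift μ₀ μ₁ τ nb t i := by
  set g : Sample V Ω → ℝ := Set.indicator {x : Sample V Ω | x.1 = true} (fun _ => (1 : ℝ)) with hg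
  have hgm : MeasurableSet {x : Sample V Ω | x.1 = true} :=
    measurable_fst (MeasurableSet.singleton true)
  have hgi : Integrable g (law V μ₀ μ₁) := (integrable_const (1 : ℝ)).indicator hgm
  have hs : (fun x : Sample V Ω => sgn x.1) = (2 : ℝ) • g - fun _ => (1 : ℝ) := by
    funext x
    obtain ⟨b, ω⟩ := x
    cases b <;> simp [sgn, hg, Set.indicator]; norm_num
  rw [hs]
  have h1 := condExp_sub (μ := law V μ₀ μ₁) (hgi.smul (2 : ℝ)) (integrable_const (1 : ℝ))
    (infoFiltration μ₀ μ₁ τ G i t)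
  have h2 := condExp_smul (μ := law V μ₀ μ₁) (2 : ℝ) g (infoFiltration μ₀ μ₁ τ G i t)
  have h3 := belief_ae_eq_canBelief μ₀ μ₁ τ hnb t i
  have h4 := condExp_const (μ := law V μ₀ μ₁)
    ((infoFiltration μ₀ μ₁ τ G i).le t) (1 : ℝ)
  filter_upwards [h1, h2, h3] with x hx1 hx2 hx3
  rw [hx1, Pi.sub_apply, hx2, h4]
  simp only [Pi.smul_apply, smul_eq_mul, drift]
  rw [← hx3]
  rfl

/-- The limit behaviour of the agents on a graph on which they agree: `d` is the common limit
decision and `Minf i` the limit of the drift of agent `i`. -/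
structure IsLimitDecision (τ : TieRule Ω) (nb : V → Fin D → V) (d : (V → Ω) → Bool)
    (Minf : V → Sample V Ω → ℝ) : Prop where
  measurable_decision : Measurable d
  measurable_limit : ∀ i, Measurable (Minf i)
  tendsto : ∀ i, ∀ᵐ x ∂(law V μ₀ μ₁),
    Tendsto (fun t => drift μ₀ μ₁ τ nb t i x) atTop (𝓝 (Minf i x))
  sgn_mul : ∀ i, ∀ᵐ x ∂(law V μ₀ μ₁), sgn (d x.2) * Minf i x = |Minf i x|
  -- This and the next two fields test conditional expectations of the state against functions of
  -- what agent `i` knows, at time `t` or in the limit; from here on no σ-algebra has to be handled.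
  integral_drift : ∀ (i : V) (t : ℕ) (h : ℝ × Bool → ℝ), Measurable h → (∀ q, |h q| ≤ 1) →
    ∫ x, h (drift μ₀ μ₁ τ nb t i x, canonicalAction μ₀ μ₁ τ nb t i x.2) * sgn x.1 ∂(law V μ₀ μ₁) =
    ∫ x, h (drift μ₀ μ₁ τ nb t i x, canonicalAction μ₀ μ₁ τ nb t i x.2) *
      drift μ₀ μ₁ τ nb t i x ∂(law V μ₀ μ₁)
  integral_limit : ∀ (i : V) (t : ℕ) (h : ℝ × Bool × Bool → ℝ), Measurable h → (∀ q, |h q| ≤ 1) →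
    ∫ x, h (drift μ₀ μ₁ τ nb t i x, canonicalAction μ₀ μ₁ τ nb t i x.2, d x.2) * sgn x.1
      ∂(law V μ₀ μ₁) =
    ∫ x, h (drift μ₀ μ₁ τ nb t i x, canonicalAction μ₀ μ₁ τ nb t i x.2, d x.2) *
      Minf i x ∂(law V μ₀ μ₁)
  integral_signal : ∀ (i : V) (B : Set Ω), MeasurableSet B →
    ∫ x, B.indicator (fun _ => 1) (x.2 i) * sgn x.1 ∂(law V μ₀ μ₁) =
    ∫ x, B.indicator (fun _ => 1) (x.2 i) * Minf i x ∂(law V μ₀ μ₁)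

/-- Only here does agreement enter the general argument. The decision is read off from one reference
agent; by agreement every other agent can reconstruct it almost surely from its own actions. An
agent whose limiting drift is nonzero eventually acts according to its sign, so the decision is
optimal for all. -/
theorem exists_isLimitDecision [Nonempty V] (τ : TieRule Ω) {G : SimpleGraph V} [G.LocallyFinite]
    {nb : V → Fin D → V} (hnb : IsLabelling G nb) (hA : LimitAgreement μ₀ μ₁ τ G) :
    ∃ d Minf, IsLimitDecision μ₀ μ₁ τ nb d Minf := by
  classical
  obtain ⟨A, -, hA⟩ := hA
  let i₀ : V := Classical.arbitrary V
  -- When both actions recur, `d` takes the value `false`. This is harmless, since recurrence of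
  -- both actions forces the limiting drift to vanish.
  let d : (V → Ω) → Bool := fun ω =>
    if ∀ᶠ t in atTop, canonicalAction μ₀ μ₁ τ nb t i₀ ω = true then true else false
  have hact : ∀ i, ∀ᵐ x ∂(law V μ₀ μ₁), ∀ t, action μ₀ μ₁ τ G t i x =
      canonicalAction μ₀ μ₁ τ nb t i x.2 := fun i =>
    ae_all_iff.2 fun t => action_ae_eq_canonicalAction μ₀ μ₁ τ hnb t i
  have hd : Measurable d := by
    refine Measurable.ite ?_ measurable_const measurable_const
    have : {ω : V → Ω | ∀ᶠ t in atTop, canonicalAction μ₀ μ₁ τ nb t i₀ ω = true} =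
        ⋃ N : ℕ, ⋂ t : ℕ, ⋂ _ : N ≤ t, canonicalAction μ₀ μ₁ τ nb t i₀ ⁻¹' {true} := by
      ext ω; simp [eventually_atTop]
    rw [this]
    exact MeasurableSet.iUnion fun N => MeasurableSet.iInter fun t => MeasurableSet.iInter fun _ =>
      measurable_canonicalAction μ₀ μ₁ τ nb t i₀ (MeasurableSet.singleton _)
  -- A version of `d` that is measurable with respect to everything agent `i` ever observes.
  let D' : V → Sample V Ω → Bool := fun i x =>
    if ∀ᶠ t in atTop, action μ₀ μ₁ τ G t i x = true then true else false
  have hD' : ∀ i, Measurable[⨆ t, infoFiltration μ₀ μ₁ τ G i t] (D' i) := by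
    intro i
    refine Measurable.ite ?_ measurable_const measurable_const
    have : {x : Sample V Ω | ∀ᶠ t in atTop, action μ₀ μ₁ τ G t i x = true} =
        ⋃ N : ℕ, ⋂ t : ℕ, ⋂ _ : N ≤ t, action μ₀ μ₁ τ G t i ⁻¹' {true} := by
      ext ω; simp [eventually_atTop]
    rw [this]
    refine MeasurableSet.iUnion fun N => MeasurableSet.iInter fun t => MeasurableSet.iInter fun _ =>
      ?_
    exact le_iSup (fun t => (infoFiltration μ₀ μ₁ τ G i t : MeasurableSpace (Sample V Ω))) t _
      ((measurable_action μ₀ μ₁ τ G t i).1 (MeasurableSet.singleton _))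
  have hdtrue : ∀ i, ∀ᵐ x ∂(law V μ₀ μ₁),
      (limitActions μ₀ μ₁ τ G i x = {true} ↔ d x.2 = true) := by
    intro i
    filter_upwards [hA, hact i₀] with x hx hx0
    rw [hx i, ← hx i₀, limitActions_eq_singleton]
    simp only [hx0, d]
    split_ifs with h <;> simp [h]
  have hdD : ∀ i, ∀ᵐ x ∂(law V μ₀ μ₁), D' i x = d x.2 := by
    intro i
    filter_upwards [hdtrue i] with x hx
    rw [limitActions_eq_singleton] at hx
    rw [Bool.eq_iff_iff, ← hx]
    simp [D']
  -- By Lévy's upward theorem this is the almost sure limit of the drifts.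
  let Minf : V → Sample V Ω → ℝ := fun i =>
    (law V μ₀ μ₁)[fun x : Sample V Ω => sgn x.1 | ⨆ t, infoFiltration μ₀ μ₁ τ G i t]
  have hle : ∀ i, (⨆ t, (infoFiltration μ₀ μ₁ τ G i t : MeasurableSpace (Sample V Ω))) ≤
      (inferInstance : MeasurableSpace (Sample V Ω)) :=
    fun i => iSup_le fun t => (infoFiltration μ₀ μ₁ τ G i).le t
  have htend : ∀ i, ∀ᵐ x ∂(law V μ₀ μ₁),
      Tendsto (fun t => drift μ₀ μ₁ τ nb t i x) atTop (𝓝 (Minf i x)) := by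
    intro i
    have h1 := tendsto_ae_condExp (μ := law V μ₀ μ₁) (ℱ := infoFiltration μ₀ μ₁ τ G i)
      (fun x : Sample V Ω => sgn x.1)
    have h2 := ae_all_iff.2 fun t => condExp_sgn_ae_eq_drift μ₀ μ₁ τ hnb t i
    filter_upwards [h1, h2] with x hx1 hx2
    exact hx1.congr hx2
  have hbel : ∀ i t, Measurable[infoFiltration μ₀ μ₁ τ G i t]
      (belief μ₀ μ₁ G t (fun s : Fin t => action μ₀ μ₁ τ G s.1) i) := fun i t =>
    stronglyMeasurable_condExp.measurable
  have hrep : ∀ i t, ∀ᵐ x ∂(law V μ₀ μ₁),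
      (2 * belief μ₀ μ₁ G t (fun s : Fin t => action μ₀ μ₁ τ G s.1) i x - 1,
        action μ₀ μ₁ τ G t i x) =
      (drift μ₀ μ₁ τ nb t i x, canonicalAction μ₀ μ₁ τ nb t i x.2) := by
    intro i t
    filter_upwards [belief_ae_eq_canBelief μ₀ μ₁ τ hnb t i, hact i] with x hx1 hx2
    rw [hx1, hx2 t]; rfl
  refine ⟨d, Minf, ⟨hd, fun i => ?_, htend, fun i => ?_, fun i t h hh h1 => ?_,
    fun i t h hh h1 => ?_, fun i B hB => ?_⟩⟩
  · exact (stronglyMeasurable_condExp.measurable).mono (hle i) le_rfl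
  · filter_upwards [htend i, hdD i, hact i] with x hx hx2 hx3
    rcases lt_trichotomy (Minf i x) 0 with h0 | h0 | h0
    · have hev : ∀ᶠ t in atTop, canonicalAction μ₀ μ₁ τ nb t i x.2 = false := by
        filter_upwards [hx.eventually (gt_mem_nhds h0)] with t ht
        have := sgn_mul_drift μ₀ μ₁ τ nb t i x
        rw [abs_of_neg ht] at this
        by_contra hc
        rw [Bool.not_eq_false] at hc
        rw [hc] at this
        simp only [sgn, if_true] at this
        linarith
      have : d x.2 = false := by
        rw [← hx2]
        have hn : ¬ ∀ᶠ t in atTop, action μ₀ μ₁ τ G t i x = true := by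
          intro hc
          obtain ⟨t, ht1, ht2⟩ := (hc.and hev).exists
          rw [hx3 t, ht2] at ht1
          exact Bool.false_ne_true ht1
        exact if_neg hn
      rw [this, abs_of_neg h0]; simp [sgn]
    · rw [h0]; simp
    · have hev : ∀ᶠ t in atTop, action μ₀ μ₁ τ G t i x = true := by
        filter_upwards [hx.eventually (lt_mem_nhds h0)] with t ht
        have := sgn_mul_drift μ₀ μ₁ τ nb t i x
        rw [abs_of_pos ht] at this
        rw [hx3 t]
        by_contra hc
        rw [Bool.not_eq_true] at hc
        rw [hc] at this
        simp only [sgn, Bool.false_eq_true, if_false] at this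
        linarith
      have : d x.2 = true := by
        rw [← hx2]
        exact if_pos hev
      rw [this, abs_of_pos h0]; simp [sgn]
  · have hH : Measurable[infoFiltration μ₀ μ₁ τ G i t] fun x =>
        h (2 * belief μ₀ μ₁ G t (fun s : Fin t => action μ₀ μ₁ τ G s.1) i x - 1,
          action μ₀ μ₁ τ G t i x) :=
      hh.comp (Measurable.prodMk (((hbel i t).const_mul 2).sub_const 1)
        (measurable_action μ₀ μ₁ τ G t i).1)
    have := integral_mul_condExp ((infoFiltration μ₀ μ₁ τ G i).le t) hH (fun _ => h1 _)
      (integrable_sgn_state (V := V) μ₀ μ₁)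
    refine Eq.trans (integral_congr_ae ?_) (this.trans (integral_congr_ae ?_))
    · filter_upwards [hrep i t] with x hx
      rw [hx]
    · filter_upwards [hrep i t, condExp_sgn_ae_eq_drift μ₀ μ₁ τ hnb t i] with x hx hx2
      rw [hx, hx2]
  · have hm := le_iSup (fun t => (infoFiltration μ₀ μ₁ τ G i t : MeasurableSpace (Sample V Ω))) t
    have hH : Measurable[⨆ t, infoFiltration μ₀ μ₁ τ G i t] fun x =>
        h (2 * belief μ₀ μ₁ G t (fun s : Fin t => action μ₀ μ₁ τ G s.1) i x - 1,
          action μ₀ μ₁ τ G t i x, D' i x) :=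
      hh.comp (Measurable.prodMk ((((hbel i t).mono hm le_rfl).const_mul 2).sub_const 1)
        (Measurable.prodMk ((measurable_action μ₀ μ₁ τ G t i).1.mono hm le_rfl) (hD' i)))
    have := integral_mul_condExp (hle i) hH (fun _ => h1 _)
      (integrable_sgn_state (V := V) μ₀ μ₁)
    have hr : ∀ᵐ x ∂(law V μ₀ μ₁),
        h (2 * belief μ₀ μ₁ G t (fun s : Fin t => action μ₀ μ₁ τ G s.1) i x - 1,
          action μ₀ μ₁ τ G t i x, D' i x) =
        h (drift μ₀ μ₁ τ nb t i x, canonicalAction μ₀ μ₁ τ nb t i x.2, d x.2) := by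
      filter_upwards [hrep i t, hdD i] with x hx hx2
      rw [Prod.mk.injEq] at hx
      rw [hx.1, hx.2, hx2]
    refine Eq.trans (integral_congr_ae ?_) (this.trans (integral_congr_ae ?_))
    · filter_upwards [hr] with x hx
      rw [hx]
    · filter_upwards [hr] with x hx
      rw [hx]
  · have hm := le_iSup (fun t => (infoFiltration μ₀ μ₁ τ G i t : MeasurableSpace (Sample V Ω))) 0
    have hsig : Measurable[⨆ t, infoFiltration μ₀ μ₁ τ G i t] (fun x : Sample V Ω => x.2 i) :=
      Measurable.of_comap_le (le_sup_left.trans hm)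
    exact integral_mul_condExp (hle i) ((measurable_const.indicator hB).comp hsig) (C := 1)
      (fun x => by by_cases h : x.2 i ∈ B <;> simp [h]) (integrable_sgn_state (V := V) μ₀ μ₁)

end Limit

/-! ### Labelled networks and their ultralimits. -/

/-- An infinite connected graph with a labelling of the closed neighbourhoods by `Fin D`. -/
structure Network (D : ℕ) where
  /-- the agents -/
  V : Type
  /-- the social network -/
  G : SimpleGraph V
  /-- all degrees are finite -/
  locallyFinite : G.LocallyFinite
  connected : G.Connected
  infinite : Infinite V
  /-- the enumeration of the closed neighbourhoods -/
  nb : V → Fin D → V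
  isLabelling : IsLabelling G nb

attribute [instance] Network.locallyFinite Network.infinite

theorem exists_isLabelling {V : Type*} (G : SimpleGraph V) [G.LocallyFinite] {d : ℕ}
    (hd : ∀ i, G.degree i ≤ d) : ∃ nb : V → Fin (d + 1) → V, IsLabelling G nb := by
  classical
  have h : ∀ j, ∃ f : Fin (d + 1) → V, Set.range f = insert j (G.neighborSet j) := by
    intro j
    let s : Finset V := insert j (G.neighborFinset j)
    have hs : s.card ≤ d + 1 := (Finset.card_insert_le _ _).trans (by
      rw [SimpleGraph.card_neighborFinset_eq_degree]; exact Nat.succ_le_succ (hd j))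
    have hs' : (s : Set V) = insert j (G.neighborSet j) := by simp [s]
    rw [← hs']
    refine ⟨fun a => if h : a.1 < s.card then (s.equivFin.symm ⟨a, h⟩ : V) else j, ?_⟩
    ext v
    constructor
    · rintro ⟨a, rfl⟩
      dsimp only
      split_ifs with h
      · exact (s.equivFin.symm ⟨a, h⟩).2
      · simp [s]
    · intro hv
      have hv' : v ∈ s := hv
      refine ⟨⟨(s.equivFin ⟨v, hv'⟩).1, (s.equivFin ⟨v, hv'⟩).2.trans_le hs⟩, ?_⟩
      simp
  choose nb hnb using h
  exact ⟨nb, hnb⟩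

theorem SameBall.shift {V V' : Type*} {D n : ℕ} {nb : V → Fin D → V} {i : V}
    {nb' : V' → Fin D → V'} {i' : V'} (w : List (Fin D))
    (h : SameBall nb i nb' i' (w.length + n)) :
    SameBall nb (walk nb i w) nb' (walk nb' i' w) n := by
  intro u u' hu hu'
  simpa only [walk_append] using h (w ++ u) (w ++ u') (by simpa using hu) (by simpa using hu')

section Ultralimit

variable {V : Type*} {D : ℕ}

theorem exists_walk_eq {G : SimpleGraph V} {nb : V → Fin D → V} (hnb : IsLabelling G nb)
    (hG : G.Connected) (i v : V) : ∃ w, walk nb i w = v := by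
  have h := (SimpleGraph.reachable_iff_reflTransGen i v).1 (hG.preconnected i v)
  induction h with
  | refl => exact ⟨[], rfl⟩
  | @tail b c _ hbc ih =>
    obtain ⟨w, hw⟩ := ih
    have : c ∈ Set.range (nb b) := by rw [hnb b]; exact Or.inr hbc
    obtain ⟨a, ha⟩ := this
    exact ⟨w ++ [a], by rw [walk_concat, hw, ha]⟩

/-- Otherwise the ball of radius `n` would be closed under taking neighbours, hence the whole graph,
although it is finite. -/
theorem exists_walk_notMem_ball [Infinite V] {G : SimpleGraph V} {nb : V → Fin D → V}
    (hnb : IsLabelling G nb) (hG : G.Connected) (i : V) (n : ℕ) :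
    ∃ w : List (Fin D), w.length ≤ n + 1 ∧
      ∀ w' : List (Fin D), w'.length ≤ n → walk nb i w ≠ walk nb i w' := by
  by_contra! hc
  have hball : ∀ v, v ∈ ball nb i n := by
    intro v
    obtain ⟨w, rfl⟩ := exists_walk_eq hnb hG i v
    induction w using List.reverseRecOn with
    | nil => exact mem_ball.2 ⟨[], by simp, rfl⟩
    | append_singleton w a ih =>
      obtain ⟨u, hu, h⟩ := mem_ball.1 ih
      obtain ⟨w', hw', h'⟩ := hc (u ++ [a]) (by simpa using hu)
      refine mem_ball.2 ⟨w', hw', ?_⟩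
      rw [← h', walk_concat, walk_concat, h]
  exact Set.infinite_univ ((ball nb i n).finite_toSet.subset fun v _ => hball v)

/-- An ultrafilter selects one of finitely many alternatives; with finitely many labels, this is how
local properties pass to the ultralimit. -/
theorem exists_eventually_of_eventually_exists {ι α : Type*} [Finite ι] (U : Ultrafilter α)
    {p : ι → α → Prop} (h : ∀ᶠ m in U, ∃ b, p b m) : ∃ b, ∀ᶠ m in U, p b m := by
  by_contra! hc
  have : ∀ᶠ m in U, ∀ b, ¬ p b m := eventually_all.2 hc
  obtain ⟨m, ⟨b, hb⟩, hm⟩ := (h.and this).exists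
  exact hm b hb

variable (U : Ultrafilter ℕ) (N : ℕ → Network D) (i : ∀ m, (N m).V)

/-- Two words are identified if almost all the walks that they describe have the same end. -/
def ultraSetoid : Setoid (List (Fin D)) where
  r w w' := ∀ᶠ m in U, walk (N m).nb (i m) w = walk (N m).nb (i m) w'
  iseqv := ⟨fun _ => Eventually.of_forall fun _ => rfl, fun h => h.mono fun _ => Eq.symm,
    fun h h' => (h.and h').mono fun _ h => h.1.trans h.2⟩

/-- The agents of the ultralimit of rooted networks. -/
abbrev UltraV : Type := Quotient (ultraSetoid U N i)

theorem ultra_eq {w w' : List (Fin D)} :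
    (Quotient.mk (ultraSetoid U N i) w = Quotient.mk (ultraSetoid U N i) w') ↔
      ∀ᶠ m in U, walk (N m).nb (i m) w = walk (N m).nb (i m) w' :=
  Quotient.eq

/-- The labelling of the ultralimit. -/
def ultraNb (x : UltraV U N i) (a : Fin D) : UltraV U N i :=
  Quotient.liftOn x (fun w => Quotient.mk (ultraSetoid U N i) (w ++ [a])) fun w w' h => by
    have h' : ∀ᶠ m in U, walk (N m).nb (i m) w = walk (N m).nb (i m) w' := h
    exact (ultra_eq U N i).2 (h'.mono fun m hm => by rw [walk_concat, walk_concat, hm])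

theorem walk_ultraNb (w u : List (Fin D)) :
    walk (ultraNb U N i) (Quotient.mk (ultraSetoid U N i) w) u =
      Quotient.mk (ultraSetoid U N i) (w ++ u) := by
  induction u using List.reverseRecOn with
  | nil => simp [walk]
  | append_singleton u a ih =>
    rw [walk_concat, ih, ← List.append_assoc]; rfl

theorem exists_ultraNb_reverse (x : UltraV U N i) (a : Fin D) :
    ∃ b, ultraNb U N i (ultraNb U N i x a) b = x := by
  induction x using Quotient.inductionOn with
  | h w =>
    have h : ∀ᶠ m in U, ∃ b, walk (N m).nb (i m) (w ++ [a] ++ [b]) = walk (N m).nb (i m) w :=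
      Eventually.of_forall fun m => by
        obtain ⟨u, hu, h⟩ := exists_walk_reverse (N m).isLabelling [a] (walk (N m).nb (i m) w)
        obtain ⟨b, rfl⟩ := List.length_eq_one_iff.1 hu
        exact ⟨b, by rw [walk_append, walk_append, h]⟩
    obtain ⟨b, hb⟩ := exists_eventually_of_eventually_exists U h
    exact ⟨b, (ultra_eq U N i).2 hb⟩

theorem exists_ultraNb_self (x : UltraV U N i) : ∃ a, ultraNb U N i x a = x := by
  induction x using Quotient.inductionOn with
  | h w =>
    have h : ∀ᶠ m in U, ∃ a, walk (N m).nb (i m) (w ++ [a]) = walk (N m).nb (i m) w :=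
      Eventually.of_forall fun m => by
        have : walk (N m).nb (i m) w ∈ Set.range ((N m).nb (walk (N m).nb (i m) w)) := by
          rw [(N m).isLabelling]; exact Or.inl rfl
        obtain ⟨a, ha⟩ := this
        exact ⟨a, by rw [walk_concat, ha]⟩
    obtain ⟨a, ha⟩ := exists_eventually_of_eventually_exists U h
    exact ⟨a, (ultra_eq U N i).2 ha⟩

/-- The graph of the ultralimit. -/
def ultraGraph : SimpleGraph (UltraV U N i) where
  Adj x y := x ≠ y ∧ ∃ a, ultraNb U N i x a = y
  symm := ⟨fun x y h => ⟨h.1.symm, by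
    obtain ⟨-, a, rfl⟩ := h
    exact exists_ultraNb_reverse U N i x a⟩⟩
  loopless := ⟨fun x h => h.1 rfl⟩

theorem isLabelling_ultraNb : IsLabelling (ultraGraph U N i) (ultraNb U N i) := by
  intro x
  ext y
  constructor
  · rintro ⟨a, rfl⟩
    by_cases h : ultraNb U N i x a = x
    · exact Or.inl h
    · exact Or.inr ⟨fun h' => h h'.symm, a, rfl⟩
  · rintro (rfl | ⟨-, a, rfl⟩)
    · exact exists_ultraNb_self U N i y
    · exact ⟨a, rfl⟩

theorem connected_ultraGraph : (ultraGraph U N i).Connected := by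
  have hroot : ∀ x, (ultraGraph U N i).Reachable (Quotient.mk (ultraSetoid U N i) []) x := by
    intro x
    induction x using Quotient.inductionOn with
    | h w =>
      induction w using List.reverseRecOn with
      | nil => exact SimpleGraph.Reachable.refl _
      | append_singleton w a ih =>
        by_cases h : Quotient.mk (ultraSetoid U N i) w =
            Quotient.mk (ultraSetoid U N i) (w ++ [a])
        · rw [← h]; exact ih
        · exact ih.trans (SimpleGraph.Adj.reachable ⟨h, a, rfl⟩)
  have : Nonempty (UltraV U N i) := ⟨Quotient.mk (ultraSetoid U N i) []⟩
  exact ⟨fun x y => (hroot x).symm.trans (hroot y)⟩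

/-- If the quotient were finite, its representatives would have length at most some `n`. In each
network some word of length at most `n + 1` leaves the ball of radius `n`, and one such word `w`
serves almost all of them; yet `w` must be identified with its short representative. -/
theorem infinite_ultraV : Infinite (UltraV U N i) := by
  by_contra hc
  rw [not_infinite_iff_finite] at hc
  have hfin := Set.finite_range fun x : UltraV U N i => x.out.length
  obtain ⟨n, hn⟩ := hfin.bddAbove
  have h : ∀ᶠ m in U, ∃ w : {w : List (Fin D) | w.length ≤ n + 1}, ∀ w' : List (Fin D),
      w'.length ≤ n → walk (N m).nb (i m) w.1 ≠ walk (N m).nb (i m) w' :=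
    Eventually.of_forall fun m => by
      obtain ⟨w, hw, h⟩ := exists_walk_notMem_ball (N m).isLabelling (N m).connected (i m) n
      exact ⟨⟨w, hw⟩, h⟩
  have := (finite_words D (n + 1)).to_subtype
  obtain ⟨w, hw⟩ := exists_eventually_of_eventually_exists U h
  let x : UltraV U N i := Quotient.mk (ultraSetoid U N i) w.1
  have hx : Quotient.mk (ultraSetoid U N i) x.out = x := Quotient.out_eq x
  obtain ⟨m, hm, hm'⟩ := (hw.and ((ultra_eq U N i).1 hx)).exists
  exact hm x.out (hn ⟨x, rfl⟩) hm'.symm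

/-- The ultralimit of a sequence of rooted networks. -/
noncomputable def ultraNetwork : Network D where
  V := UltraV U N i
  G := ultraGraph U N i
  locallyFinite := fun x => by
    have h : ((ultraGraph U N i).neighborSet x).Finite :=
      (Set.finite_range (ultraNb U N i x)).subset fun y hy => by
        rw [isLabelling_ultraNb U N i x]; exact Or.inr hy
    exact h.fintype
  connected := connected_ultraGraph U N i
  infinite := infinite_ultraV U N i
  nb := ultraNb U N i
  isLabelling := isLabelling_ultraNb U N i

/-- For each pair of words the ultrafilter decides whether the endpoints coincide, in accordance
with the quotient; only finitely many pairs have length at most `n`. -/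
theorem eventually_sameBall_ultra (n : ℕ) :
    ∀ᶠ m in U, SameBall (N m).nb (i m) (ultraNb U N i) (Quotient.mk (ultraSetoid U N i) []) n := by
  have h : ∀ u u' : List (Fin D), ∀ᶠ m in U,
      (walk (N m).nb (i m) u = walk (N m).nb (i m) u' ↔
        walk (ultraNb U N i) (Quotient.mk (ultraSetoid U N i) []) u =
        walk (ultraNb U N i) (Quotient.mk (ultraSetoid U N i) []) u') := by
    intro u u'
    rw [walk_ultraNb, walk_ultraNb, List.nil_append, List.nil_append, ultra_eq]
    by_cases hp : ∀ᶠ m in U, walk (N m).nb (i m) u = walk (N m).nb (i m) u'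
    · exact hp.mono fun m hm => iff_of_true hm hp
    · exact (Ultrafilter.eventually_not.2 hp).mono fun m hm => iff_of_false hm hp
  have h2 := (finite_words D n).eventually_all (l := (U : Filter ℕ)) |>.2 fun u _ =>
    ((finite_words D n).eventually_all (l := (U : Filter ℕ))).2 fun u' _ => h u u'
  exact h2.mono fun m hm u u' hu hu' => hm u hu u' hu'

/-- Rooted networks converge along an ultrafilter to a rooted network. -/
theorem exists_limit_network : ∃ (H : Network D) (o : H.V), ∀ (w : List (Fin D)) (n : ℕ),
    ∀ᶠ m in U, SameBall (N m).nb (walk (N m).nb (i m) w) H.nb (walk H.nb o w) n :=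
  ⟨ultraNetwork U N i, Quotient.mk (ultraSetoid U N i) [], fun w n =>
    (eventually_sameBall_ultra U N i (w.length + n)).mono fun _ h => h.shift w⟩

end Ultralimit

/-! ### The value of the limit decision. -/

section Value

variable {V V' Ω : Type*} [MeasurableSpace Ω] {D : ℕ}
variable (μ₀ μ₁ : Measure Ω) [IsProbabilityMeasure μ₀] [IsProbabilityMeasure μ₁]

/-- The correlation `E[± S]` of a decision with the state; the decision is correct with probability
`(1 + value) / 2`. -/
noncomputable def value (d : (V → Ω) → Bool) : ℝ :=
  ∫ x, sgn (d x.2) * sgn x.1 ∂(law V μ₀ μ₁)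

theorem SameBall.integral_eq (τ : TieRule Ω) {nb : V → Fin D → V} {i : V}
    {nb' : V' → Fin D → V'} {i' : V'} {t : ℕ} (hs : SameBall nb i nb' i' (t + 1))
    {Φ : Bool × ℝ × Bool → ℝ} (hΦ : Measurable Φ) :
    ∫ x, Φ (x.1, drift μ₀ μ₁ τ nb t i x, canonicalAction μ₀ μ₁ τ nb t i x.2) ∂(law V μ₀ μ₁) =
    ∫ x, Φ (x.1, drift μ₀ μ₁ τ nb' t i' x, canonicalAction μ₀ μ₁ τ nb' t i' x.2)
      ∂(law V' μ₀ μ₁) := by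
  have h := hs.map_law_canonical μ₀ μ₁ τ
  let Ψ : Bool × ℝ × Bool → ℝ := fun q => Φ (q.1, 2 * q.2.1 - 1, q.2.2)
  have hΨ : Measurable Ψ := hΦ.comp (measurable_fst.prodMk
    (((measurable_fst.comp measurable_snd).const_mul 2 |>.sub_const 1).prodMk
      (measurable_snd.comp measurable_snd)))
  have hm : Measurable fun x : Sample V Ω =>
      (x.1, canBelief μ₀ μ₁ τ nb t i x.2, canonicalAction μ₀ μ₁ τ nb t i x.2) :=
    measurable_fst.prodMk (((measurable_canBelief μ₀ μ₁ τ nb t i).comp measurable_snd).prodMk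
      ((measurable_canonicalAction μ₀ μ₁ τ nb t i).comp measurable_snd))
  have hm' : Measurable fun x : Sample V' Ω =>
      (x.1, canBelief μ₀ μ₁ τ nb' t i' x.2, canonicalAction μ₀ μ₁ τ nb' t i' x.2) :=
    measurable_fst.prodMk (((measurable_canBelief μ₀ μ₁ τ nb' t i').comp measurable_snd).prodMk
      ((measurable_canonicalAction μ₀ μ₁ τ nb' t i').comp measurable_snd))
  have h1 := integral_map (μ := law V μ₀ μ₁) hm.aemeasurable
    (hΨ.aestronglyMeasurable (μ := (law V μ₀ μ₁).map _))
  have h2 := integral_map (μ := law V' μ₀ μ₁) hm'.aemeasurable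
    (hΨ.aestronglyMeasurable (μ := (law V' μ₀ μ₁).map _))
  rw [h] at h1
  exact h1.symm.trans h2

theorem integrable_decision {f : (V → Ω) → Bool} (hf : Measurable f) :
    Integrable (fun x : Sample V Ω => sgn (f x.2)) (law V μ₀ μ₁) :=
  integrable_of_abs_le (measurable_sgn.comp (hf.comp measurable_snd)) (C := 1)
    fun _ => (abs_sgn _).le

theorem integral_mul_sgn {f : (V → Ω) → ℝ} (hf : Measurable f) {C : ℝ} (hC : ∀ x, |f x| ≤ C) :
    ∫ x, f x.2 * sgn x.1 ∂(law V μ₀ μ₁) = ∫ x, f x.2 * stateInd true x ∂(law V μ₀ μ₁) -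
      ∫ x, f x.2 * stateInd false x ∂(law V μ₀ μ₁) := by
  have hi (b : Bool) : Integrable (fun x : Sample V Ω => f x.2 * stateInd b x) (law V μ₀ μ₁) :=
    (integrable_of_abs_le (hf.comp measurable_snd) fun x => hC x.2).mul_bdd (c := 1)
      (measurable_stateInd b).aestronglyMeasurable (ae_of_all _ fun x => abs_stateInd_le b x)
  rw [← integral_sub (hi true) (hi false)]
  simp only [sgn_eq_stateInd, mul_sub]

theorem integral_eq_add_stateInd {f : (V → Ω) → ℝ} (hf : Measurable f) {C : ℝ}
    (hC : ∀ x, |f x| ≤ C) :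
    ∫ x, f x.2 ∂(law V μ₀ μ₁) = ∫ x, f x.2 * stateInd true x ∂(law V μ₀ μ₁) +
      ∫ x, f x.2 * stateInd false x ∂(law V μ₀ μ₁) := by
  have hi (b : Bool) : Integrable (fun x : Sample V Ω => f x.2 * stateInd b x) (law V μ₀ μ₁) :=
    (integrable_of_abs_le (hf.comp measurable_snd) fun x => hC x.2).mul_bdd (c := 1)
      (measurable_stateInd b).aestronglyMeasurable (ae_of_all _ fun x => abs_stateInd_le b x)
  rw [← integral_add (hi true) (hi false)]
  simp only [← mul_add, stateInd_add, mul_one]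

variable {μ₀ μ₁}
variable {τ : TieRule Ω} {nb : V → Fin D → V} {d : (V → Ω) → Bool} {M : V → Sample V Ω → ℝ}

namespace IsLimitDecision

theorem abs_limit_le (hL : IsLimitDecision μ₀ μ₁ τ nb d M) (i : V) :
    ∀ᵐ x ∂(law V μ₀ μ₁), |M i x| ≤ 1 := by
  filter_upwards [hL.tendsto i] with x hx
  exact le_of_tendsto hx.abs (Eventually.of_forall fun t => abs_drift_le μ₀ μ₁ τ nb t i x)

theorem integrable_limit (hL : IsLimitDecision μ₀ μ₁ τ nb d M) (i : V) :
    Integrable (M i) (law V μ₀ μ₁) :=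
  Integrable.of_bound (hL.measurable_limit i).aestronglyMeasurable 1 (hL.abs_limit_le i)

theorem integral_limit_eq_zero (hL : IsLimitDecision μ₀ μ₁ τ nb d M) (i : V) :
    ∫ x, M i x ∂(law V μ₀ μ₁) = 0 := by
  have h := hL.integral_limit i 0 (fun _ => 1) measurable_const (by simp)
  simp only [one_mul] at h
  have h2 := integral_mul_sgn (V := V) μ₀ μ₁ (f := fun _ => 1) measurable_const (C := 1) (by simp)
  simp only [one_mul, integral_stateInd, sub_self] at h2
  rw [← h, h2]

/-- The decision is known to agent `i` in the limit, so the state may be replaced by `M i` in its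
correlation with `d`. In particular the left side is the same for all agents. -/
theorem integral_abs_limit (hL : IsLimitDecision μ₀ μ₁ τ nb d M) (i : V) :
    ∫ x, |M i x| ∂(law V μ₀ μ₁) = value μ₀ μ₁ d := by
  have h := hL.integral_limit i 0 (fun q => sgn q.2.2)
    (measurable_sgn.comp (measurable_snd.comp measurable_snd)) fun q => (abs_sgn _).le
  rw [value, h]
  exact integral_congr_ae ((hL.sgn_mul i).mono fun _ h => h.symm)

theorem integral_sgn_action (hL : IsLimitDecision μ₀ μ₁ τ nb d M) (i : V) (t : ℕ) :
    ∫ x, sgn (canonicalAction μ₀ μ₁ τ nb t i x.2) * sgn x.1 ∂(law V μ₀ μ₁) =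
      ∫ x, |drift μ₀ μ₁ τ nb t i x| ∂(law V μ₀ μ₁) := by
  have h := hL.integral_drift i t (fun q => sgn q.2) (measurable_sgn.comp measurable_snd)
    fun q => (abs_sgn _).le
  simp only [sgn_mul_drift] at h
  exact h

theorem integral_sgn_action_limit (hL : IsLimitDecision μ₀ μ₁ τ nb d M) (i : V) (t : ℕ) :
    ∫ x, sgn (canonicalAction μ₀ μ₁ τ nb t i x.2) * M i x ∂(law V μ₀ μ₁) =
      ∫ x, |drift μ₀ μ₁ τ nb t i x| ∂(law V μ₀ μ₁) := by
  rw [← hL.integral_sgn_action i t]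
  exact (hL.integral_limit i t (fun q => sgn q.2.1)
    (measurable_sgn.comp (measurable_fst.comp measurable_snd)) fun q => (abs_sgn _).le).symm

theorem integrable_sgn_action_mul (hL : IsLimitDecision μ₀ μ₁ τ nb d M) (i : V) (t : ℕ) :
    Integrable (fun x => sgn (canonicalAction μ₀ μ₁ τ nb t i x.2) * M i x) (law V μ₀ μ₁) :=
  (hL.integrable_limit i).bdd_mul (c := 1) (measurable_sgn.comp ((measurable_canonicalAction μ₀ μ₁ τ
    nb t i).comp measurable_snd)).aestronglyMeasurable (ae_of_all _ fun _ => (abs_sgn _).le)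

theorem integral_abs_drift_le (hL : IsLimitDecision μ₀ μ₁ τ nb d M) (i : V) (t : ℕ) :
    ∫ x, |drift μ₀ μ₁ τ nb t i x| ∂(law V μ₀ μ₁) ≤ value μ₀ μ₁ d := by
  rw [← hL.integral_sgn_action_limit i t, ← hL.integral_abs_limit i]
  refine integral_mono (hL.integrable_sgn_action_mul i t) (hL.integrable_limit i).abs fun x => ?_
  refine (le_abs_self _).trans ?_
  rw [abs_mul, abs_sgn, one_mul]

theorem tendsto_integral_abs_drift (hL : IsLimitDecision μ₀ μ₁ τ nb d M) (i : V) :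
    Tendsto (fun t => ∫ x, |drift μ₀ μ₁ τ nb t i x| ∂(law V μ₀ μ₁)) atTop
      (𝓝 (value μ₀ μ₁ d)) := by
  rw [← hL.integral_abs_limit i]
  refine tendsto_integral_of_dominated_convergence (fun _ => 1)
    (fun t => (measurable_drift μ₀ μ₁ τ nb t i).abs.aestronglyMeasurable) (integrable_const 1)
    (fun t => ae_of_all _ fun x => ?_) ((hL.tendsto i).mono fun x hx => hx.abs)
  rw [Real.norm_eq_abs, abs_abs]
  exact abs_drift_le μ₀ μ₁ τ nb t i x

/-- A zero value makes the limiting drift vanish, so an agent's own signal is uncorrelated with the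
state and the two signal laws coincide. -/
theorem value_pos [Nonempty V] (hL : IsLimitDecision μ₀ μ₁ τ nb d M) (hne : μ₀ ≠ μ₁) :
    0 < value μ₀ μ₁ d := by
  let i : V := Classical.arbitrary V
  rw [← hL.integral_abs_limit i]
  refine lt_of_le_of_ne (integral_nonneg fun x => abs_nonneg _) fun h0 => hne ?_
  have hM : ∀ᵐ x ∂(law V μ₀ μ₁), M i x = 0 := by
    have := (integral_eq_zero_iff_of_nonneg (fun x => abs_nonneg (M i x))
      (hL.integrable_limit i).abs).1 h0.symm
    exact this.mono fun x hx => abs_eq_zero.1 hx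
  ext B hB
  have hB1 : ∀ y : Ω, |B.indicator (fun _ => (1 : ℝ)) y| ≤ 1 := fun y => by
    by_cases h : y ∈ B <;> simp [h]
  have hBm : Measurable (B.indicator fun _ => (1 : ℝ)) := measurable_const.indicator hB
  have h1 := hL.integral_signal i B hB
  have h2 : ∫ x, B.indicator (fun _ => 1) (x.2 i) * M i x ∂(law V μ₀ μ₁) = 0 := by
    rw [integral_congr_ae (g := fun _ => (0 : ℝ)) (hM.mono fun x hx => by simp [hx])]
    simp
  have hf : Measurable fun ω : V → Ω => B.indicator (fun _ => (1 : ℝ)) (ω i) :=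
    hBm.comp (measurable_pi_apply i)
  rw [h2, integral_mul_sgn (V := V) μ₀ μ₁ (f := fun ω => B.indicator (fun _ => 1) (ω i)) hf
    (C := 1) fun ω => hB1 _,
    integral_mul_stateInd μ₀ μ₁ (f := fun ω => B.indicator (fun _ => 1) (ω i)) hf (fun ω => hB1 _),
    integral_mul_stateInd μ₀ μ₁ (f := fun ω => B.indicator (fun _ => 1) (ω i)) hf
      (fun ω => hB1 _)] at h1
  have h3 (μ : Measure Ω) [IsProbabilityMeasure μ] :
      ∫ ω, B.indicator (fun _ => (1 : ℝ)) (ω i) ∂(Measure.infinitePi fun _ : V => μ) = μ.real B := by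
    have := integral_map (μ := Measure.infinitePi fun _ : V => μ)
      (measurable_pi_apply i).aemeasurable (hBm.aestronglyMeasurable (μ := Measure.map (fun ω => ω i)
        (Measure.infinitePi fun _ : V => μ)))
    have he := (measurePreserving_eval_infinitePi (fun _ : V => μ) i).map_eq
    change Measure.map (fun ω : V → Ω => ω i) _ = _ at he
    rw [← this, he, integral_indicator hB]
    simp
  simp only [signalLaw, h3] at h1
  have h4 : μ₀.real B = μ₁.real B := by linarith
  exact (measureReal_eq_measureReal_iff (measure_ne_top _ _) (measure_ne_top _ _)).1 h4

end IsLimitDecision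

end Value

/-! ### Limits of networks: semicontinuity of the value and bounds on the drift. -/

section LimitNetwork

variable {V V' Ω : Type*} [MeasurableSpace Ω] {D : ℕ}
variable {μ₀ μ₁ : Measure Ω} [IsProbabilityMeasure μ₀] [IsProbabilityMeasure μ₁]
variable {τ : TieRule Ω}

/-- The limiting value is lower semicontinuous in the rooted network. -/
theorem value_le_of_tendsto {N : ℕ → Network D} {i : ∀ m, (N m).V} {nb' : V' → Fin D → V'}
    {o : V'} {U : Filter ℕ} [U.NeBot]
    (hs : ∀ n, ∀ᶠ m in U, SameBall (N m).nb (i m) nb' o n)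
    {d : ∀ m, ((N m).V → Ω) → Bool} {M : ∀ m, (N m).V → Sample (N m).V Ω → ℝ}
    (hL : ∀ m, IsLimitDecision μ₀ μ₁ τ (N m).nb (d m) (M m))
    {d' : (V' → Ω) → Bool} {M' : V' → Sample V' Ω → ℝ}
    (hL' : IsLimitDecision μ₀ μ₁ τ nb' d' M') {c : ℝ}
    (hc : Tendsto (fun m => value μ₀ μ₁ (d m)) U (𝓝 c)) : value μ₀ μ₁ d' ≤ c := by
  -- At a fixed time the mean modulus of the drift is local, so it agrees with that on almost all
  -- approximating networks, where it is at most the value.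
  refine le_of_tendsto' (hL'.tendsto_integral_abs_drift o) fun t => ?_
  refine ge_of_tendsto hc ?_
  filter_upwards [hs (t + 1)] with m hm
  have h := hm.integral_eq μ₀ μ₁ τ (Φ := fun q => |q.2.1|) (measurable_fst.comp measurable_snd).abs
  dsimp only at h
  rw [← h]
  exact (hL m).integral_abs_drift_le (i m) t

/-- The inequality is tested on the set where it fails. -/
theorem ae_nonneg_of_integral_indicator {α : Type*} {_ : MeasurableSpace α} {μ : Measure α}
    [IsFiniteMeasure μ] {Y : α → ℝ} (hY : Measurable Y) (hY1 : ∀ x, |Y x| ≤ 1) {a b : ℝ}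
    (h : ∀ B : Set ℝ, MeasurableSet B →
      0 ≤ ∫ x, B.indicator (fun _ => 1) (Y x) * (a * Y x + b) ∂μ) :
    ∀ᵐ x ∂μ, 0 ≤ a * Y x + b := by
  let B : Set ℝ := {y | a * y + b < 0}
  have hB : MeasurableSet B := measurableSet_lt (by fun_prop) measurable_const
  have hBm : Measurable (B.indicator fun _ => (1 : ℝ)) := measurable_const.indicator hB
  let g : α → ℝ := fun x => -(B.indicator (fun _ => 1) (Y x) * (a * Y x + b))
  have hpt : ∀ x, g x = if a * Y x + b < 0 then -(a * Y x + b) else 0 := by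
    intro x
    by_cases hx : a * Y x + b < 0
    · have : Y x ∈ B := hx
      simp [g, this, hx]
    · have : Y x ∉ B := hx
      simp [g, this, hx]
  have hg0 : ∀ x, 0 ≤ g x := by
    intro x; rw [hpt]; split_ifs with hx <;> linarith
  have hgi : Integrable g μ := by
    refine integrable_of_abs_le (C := |a| + |b|)
      ((hBm.comp hY).mul ((hY.const_mul a).add_const b)).neg fun x => ?_
    rw [abs_of_nonneg (hg0 x), hpt]
    have h1 : |a * Y x + b| ≤ |a| + |b| := (abs_add_le _ _).trans (by
      rw [abs_mul]
      exact add_le_add (mul_le_of_le_one_right (abs_nonneg _) (hY1 x)) le_rfl)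
    split_ifs
    · exact (neg_le_abs _).trans h1
    · positivity
  have h0 : ∫ x, g x ∂μ = 0 := by
    refine le_antisymm ?_ (integral_nonneg hg0)
    rw [integral_neg]
    exact neg_nonpos.2 (h B hB)
  filter_upwards [(integral_eq_zero_iff_of_nonneg hg0 hgi).1 h0] with x hx
  have hx' : g x = 0 := hx
  rw [hpt] at hx'
  split_ifs at hx' with hlt
  · linarith
  · exact not_lt.1 hlt

/-- On a network in which agents tend to infinity, the limit decision is at least as good for those
agents as their private information: this bounds the drift on the limiting network. -/
theorem ae_drift_bounds {G : SimpleGraph V} {nb : V → Fin D → V} (hnb : IsLabelling G nb)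
    {nb' : V' → Fin D → V'} {v : V'} {U : Filter ℕ} [U.NeBot] {k : ℕ → V}
    (hk : Tendsto k U cofinite) (hs : ∀ n, ∀ᶠ m in U, SameBall nb (k m) nb' v n)
    {d : (V → Ω) → Bool} {M : V → Sample V Ω → ℝ} (hL : IsLimitDecision μ₀ μ₁ τ nb d M)
    {d' : (V' → Ω) → Bool} {M' : V' → Sample V' Ω → ℝ}
    (hL' : IsLimitDecision μ₀ μ₁ τ nb' d' M') (t : ℕ) :
    ∀ᵐ x ∂(law V' μ₀ μ₁),
      0 ≤ (1 + ∫ y, sgn (d y.2) ∂(law V μ₀ μ₁)) * drift μ₀ μ₁ τ nb' t v x + value μ₀ μ₁ d ∧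
      0 ≤ -(1 - ∫ y, sgn (d y.2) ∂(law V μ₀ μ₁)) * drift μ₀ μ₁ τ nb' t v x + value μ₀ μ₁ d := by
  have hsd : Measurable fun ω => sgn (d ω) := measurable_sgn.comp hL.measurable_decision
  have hval : value μ₀ μ₁ d = _ :=
    integral_mul_sgn (V := V) μ₀ μ₁ hsd (C := 1) fun ω => (abs_sgn _).le
  have hmean := integral_eq_add_stateInd (V := V) μ₀ μ₁ hsd (C := 1) fun ω => (abs_sgn _).le
  set e₁ := ∫ x, sgn (d x.2) * stateInd true x ∂(law V μ₀ μ₁)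
  set e₀ := ∫ x, sgn (d x.2) * stateInd false x ∂(law V μ₀ μ₁)
  set Y := drift μ₀ μ₁ τ nb' t v with hY
  have hYm : Measurable Y := measurable_drift μ₀ μ₁ τ nb' t v
  -- Here `e₁ + e₀` is the mean of `sgn d` and `e₁ - e₀` is its value.
  have key : ∀ B : Set ℝ, MeasurableSet B →
      0 ≤ ∫ x, B.indicator (fun _ => 1) (Y x) * ((1 + (e₁ + e₀)) * Y x + (e₁ - e₀))
        ∂(law V' μ₀ μ₁) ∧
      0 ≤ ∫ x, B.indicator (fun _ => 1) (Y x) * (-(1 - (e₁ + e₀)) * Y x + (e₁ - e₀))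
        ∂(law V' μ₀ μ₁) := by
    intro B hB
    set h : ℝ → ℝ := B.indicator fun _ => 1 with hh
    have hhm : Measurable h := measurable_const.indicator hB
    have hh1 : ∀ y, |h y| ≤ 1 := fun y => by by_cases hy : y ∈ B <;> simp [h, hy]
    have hh0 : ∀ y, 0 ≤ h y := fun y => by by_cases hy : y ∈ B <;> simp [h, hy]
    -- the quantities on the limiting network
    set I : Bool → ℝ := fun b => ∫ x, h (Y x) * stateInd b x ∂(law V' μ₀ μ₁) with hI
    let f' : (V' → Ω) → ℝ := fun ω => h (2 * canBelief μ₀ μ₁ τ nb' t v ω - 1)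
    have hf'm : Measurable f' :=
      hhm.comp (((measurable_canBelief μ₀ μ₁ τ nb' t v).const_mul 2).sub_const 1)
    have hI1 : ∫ x, h (Y x) * Y x ∂(law V' μ₀ μ₁) = I true - I false := by
      rw [← hL'.integral_drift v t (fun q => h q.1) (hhm.comp measurable_fst) fun q => hh1 _]
      exact integral_mul_sgn (V := V') μ₀ μ₁ hf'm (C := 1) fun ω => hh1 _
    have hI2 : ∫ x, h (Y x) ∂(law V' μ₀ μ₁) = I true + I false :=
      integral_eq_add_stateInd (V := V') μ₀ μ₁ hf'm (C := 1) fun ω => hh1 _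
    have hi1 : Integrable (fun x => h (Y x)) (law V' μ₀ μ₁) :=
      integrable_of_abs_le (hhm.comp hYm) (C := 1) fun x => hh1 _
    have hi2 : Integrable (fun x => h (Y x) * Y x) (law V' μ₀ μ₁) :=
      hi1.mul_bdd (c := 1) hYm.aestronglyMeasurable
        (ae_of_all _ fun x => abs_drift_le μ₀ μ₁ τ nb' t v x)
    have hexp (a b : ℝ) : ∫ x, h (Y x) * (a * Y x + b) ∂(law V' μ₀ μ₁) =
        a * (I true - I false) + b * (I true + I false) := by
      rw [← hI1, ← hI2, ← integral_const_mul, ← integral_const_mul,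
        ← integral_add (hi2.const_mul a) (hi1.const_mul b)]
      exact integral_congr_ae (ae_of_all _ fun x => by ring)
    -- the quantities on the network
    let f : ℕ → (V → Ω) → ℝ := fun m ω => h (2 * canBelief μ₀ μ₁ τ nb t (k m) ω - 1)
    have hfm (m : ℕ) : Measurable (f m) :=
      hhm.comp (((measurable_canBelief μ₀ μ₁ τ nb t (k m)).const_mul 2).sub_const 1)
    have hasym (b : Bool) := tendsto_asymptotic_independence μ₀ μ₁ hnb hk hfm (fun m ω => hh1 _)
      (t + 1) (fun m ω ω' hω => by
        simp only [f, (canonical_local μ₀ μ₁ τ nb (k m) t ω ω' hω).1]) hL.measurable_decision b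
    have htr (b : Bool) : ∀ᶠ m in U, ∫ x, f m x.2 * stateInd b x ∂(law V μ₀ μ₁) = I b := by
      filter_upwards [hs (t + 1)] with m hm
      exact hm.integral_eq μ₀ μ₁ τ (Φ := fun q => h q.2.1 * if q.1 = b then 1 else 0)
        ((hhm.comp (measurable_fst.comp measurable_snd)).mul
          ((measurable_from_top (f := fun c : Bool => if c = b then (1 : ℝ) else 0)).comp
            measurable_fst))
    have hX (b : Bool) : Tendsto (fun m => ∫ x, f m x.2 * sgn (d x.2) * stateInd b x
        ∂(law V μ₀ μ₁)) U
        (𝓝 (2 * I b * ∫ x, sgn (d x.2) * stateInd b x ∂(law V μ₀ μ₁))) := by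
      have := (hasym b).add_const (2 * I b * ∫ x, sgn (d x.2) * stateInd b x ∂(law V μ₀ μ₁))
      rw [zero_add] at this
      refine this.congr' ((htr b).mono fun m hm => ?_)
      simp only [hm]; ring
    have hD := (hX true).sub (hX false)
    -- Optimality of `d` for the remote agent `k m`: on any event it knows, `d` does no worse than
    -- either constant action, since `|M| ± M ≥ 0`.
    have hopt : ∀ᶠ m in U,
        0 ≤ (I true - I false) + ((∫ x, f m x.2 * sgn (d x.2) * stateInd true x ∂(law V μ₀ μ₁)) -
          ∫ x, f m x.2 * sgn (d x.2) * stateInd false x ∂(law V μ₀ μ₁)) ∧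
        0 ≤ -(I true - I false) + ((∫ x, f m x.2 * sgn (d x.2) * stateInd true x ∂(law V μ₀ μ₁)) -
          ∫ x, f m x.2 * sgn (d x.2) * stateInd false x ∂(law V μ₀ μ₁)) := by
      filter_upwards [htr true, htr false] with m hm1 hm0
      have e1 := integral_mul_sgn (V := V) μ₀ μ₁ (hfm m) (C := 1) fun ω => hh1 _
      have e2 := integral_mul_sgn (V := V) μ₀ μ₁ (f := fun ω => f m ω * sgn (d ω))
        ((hfm m).mul hsd) (C := 1) fun ω => by rw [abs_mul, abs_sgn, mul_one]; exact hh1 _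
      have l1 := hL.integral_limit (k m) t (fun q => h q.1) (hhm.comp measurable_fst) fun q => hh1 _
      have l2 := hL.integral_limit (k m) t (fun q => h q.1 * sgn q.2.2)
        ((hhm.comp measurable_fst).mul (measurable_sgn.comp (measurable_snd.comp measurable_snd)))
        fun q => by rw [abs_mul, abs_sgn, mul_one]; exact hh1 _
      change ∫ x, f m x.2 * sgn x.1 ∂(law V μ₀ μ₁) = ∫ x, f m x.2 * M (k m) x ∂(law V μ₀ μ₁) at l1
      change ∫ x, f m x.2 * sgn (d x.2) * sgn x.1 ∂(law V μ₀ μ₁) =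
        ∫ x, f m x.2 * sgn (d x.2) * M (k m) x ∂(law V μ₀ μ₁) at l2
      rw [← hm1, ← hm0, ← e1, ← e2, l1, l2]
      have j1 : Integrable (fun x => f m x.2 * M (k m) x) (law V μ₀ μ₁) :=
        (hL.integrable_limit (k m)).bdd_mul (c := 1)
          ((hfm m).comp measurable_snd).aestronglyMeasurable (ae_of_all _ fun x => hh1 _)
      have j2 : Integrable (fun x => f m x.2 * sgn (d x.2) * M (k m) x) (law V μ₀ μ₁) :=
        (hL.integrable_limit (k m)).bdd_mul (c := 1)
          (((hfm m).mul hsd).comp measurable_snd).aestronglyMeasurable (ae_of_all _ fun x => by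
            change |f m x.2 * sgn (d x.2)| ≤ 1
            rw [abs_mul, abs_sgn, mul_one]; exact hh1 _)
      rw [neg_add_eq_sub, ← integral_add j1 j2, ← integral_sub j2 j1]
      refine ⟨integral_nonneg_of_ae ?_, integral_nonneg_of_ae ?_⟩
      · filter_upwards [hL.sgn_mul (k m)] with x hx
        have : f m x.2 * M (k m) x + f m x.2 * sgn (d x.2) * M (k m) x =
          f m x.2 * (M (k m) x + |M (k m) x|) := by rw [← hx]; ring
        change 0 ≤ _
        rw [this]
        exact mul_nonneg (hh0 _) (by linarith [neg_abs_le (M (k m) x)])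
      · filter_upwards [hL.sgn_mul (k m)] with x hx
        have : f m x.2 * sgn (d x.2) * M (k m) x - f m x.2 * M (k m) x =
          f m x.2 * (|M (k m) x| - M (k m) x) := by rw [← hx]; ring
        change 0 ≤ _
        rw [this]
        exact mul_nonneg (hh0 _) (by linarith [le_abs_self (M (k m) x)])
    -- In the limit the correlation factorises given the state, and `(I₁ - I₀) + 2 (I₁ e₁ - I₀ e₀) =
    -- (1 + e₁ + e₀)(I₁ - I₀) + (e₁ - e₀)(I₁ + I₀)`, where `I₁`, `I₀` stand for `I true`, `I false`;
    -- the other sign is similar.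
    have c1 := ge_of_tendsto (hD.const_add (I true - I false)) (hopt.mono fun m hm => hm.1)
    have c2 := ge_of_tendsto (hD.const_add (-(I true - I false))) (hopt.mono fun m hm => hm.2)
    rw [hexp, hexp]
    constructor
    · linarith
    · linarith
  have a1 := ae_nonneg_of_integral_indicator hYm (abs_drift_le μ₀ μ₁ τ nb' t v)
    fun B hB => (key B hB).1
  have a2 := ae_nonneg_of_integral_indicator hYm (abs_drift_le μ₀ μ₁ τ nb' t v)
    fun B hB => (key B hB).2
  rw [hmean, hval]
  filter_upwards [a1, a2] with x h1 h2
  exact ⟨h1, h2⟩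

/-- If passing to the limiting network does not change the limiting value, then the limiting drift
on the limiting network is bounded away from zero. -/
theorem ae_value_le_abs_limit {G : SimpleGraph V} {nb : V → Fin D → V} (hnb : IsLabelling G nb)
    {nb' : V' → Fin D → V'} {v : V'} {U : Filter ℕ} [U.NeBot] {k : ℕ → V}
    (hk : Tendsto k U cofinite) (hs : ∀ n, ∀ᶠ m in U, SameBall nb (k m) nb' v n)
    {d : (V → Ω) → Bool} {M : V → Sample V Ω → ℝ} (hL : IsLimitDecision μ₀ μ₁ τ nb d M)
    {d' : (V' → Ω) → Bool} {M' : V' → Sample V' Ω → ℝ}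
    (hL' : IsLimitDecision μ₀ μ₁ τ nb' d' M') (hv : value μ₀ μ₁ d' = value μ₀ μ₁ d) :
    ∀ᵐ x ∂(law V' μ₀ μ₁), value μ₀ μ₁ d ≤ 2 * |M' v x| := by
  set r := value μ₀ μ₁ d
  set m := ∫ y, sgn (d y.2) ∂(law V μ₀ μ₁) with hm
  have hm1 : |m| ≤ 1 := by
    refine abs_integral_le_integral_abs.trans ?_
    simp [abs_sgn]
  have hb := ae_all_iff.2 fun t => ae_drift_bounds hnb hk hs hL hL' t
  have hbd : ∀ᵐ x ∂(law V' μ₀ μ₁), 0 ≤ (1 + m) * M' v x + r ∧ 0 ≤ -(1 - m) * M' v x + r := by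
    filter_upwards [hb, hL'.tendsto v] with x hx ht
    exact ⟨ge_of_tendsto' ((ht.const_mul (1 + m)).add_const r) fun t => (hx t).1,
      ge_of_tendsto' ((ht.const_mul (-(1 - m))).add_const r) fun t => (hx t).2⟩
  have hi := hL'.integrable_limit v
  -- The two one-sided bounds combine into `|M'| ≤ r + m * M'`. Both sides have mean `r`, because
  -- `M'` has mean 0 and the values agree, so equality holds almost surely.
  have hg0 : 0 ≤ᵐ[law V' μ₀ μ₁] fun x => r - |M' v x| + m * M' v x := by
    filter_upwards [hbd] with x hx
    change 0 ≤ _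
    rcases abs_cases (M' v x) with ⟨h, -⟩ | ⟨h, -⟩ <;> rw [h] <;> linarith [hx.1, hx.2]
  have hint : ∫ x, (r - |M' v x| + m * M' v x) ∂(law V' μ₀ μ₁) = 0 := by
    have hsub : Integrable (fun x => r - |M' v x|) (law V' μ₀ μ₁) :=
      (integrable_const r).sub hi.abs
    rw [integral_add hsub (hi.const_mul m),
      integral_sub (integrable_const r) hi.abs, integral_const_mul, hL'.integral_limit_eq_zero,
      hL'.integral_abs_limit, hv]
    simp
  have hz := (integral_eq_zero_iff_of_nonneg_ae hg0
    (((integrable_const r).sub hi.abs).add (hi.const_mul m))).1 hint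
  filter_upwards [hz] with x hx
  have hx' : r - |M' v x| + m * M' v x = 0 := hx
  have : |m * M' v x| ≤ |M' v x| := by
    rw [abs_mul]; exact mul_le_of_le_one_left (abs_nonneg _) hm1
  linarith [neg_abs_le (m * M' v x)]

end LimitNetwork

/-! ### The limit decision is independent of itself given the state. -/

section Conclusion

variable {V V' Ω : Type*} [MeasurableSpace Ω] {D : ℕ}
variable {μ₀ μ₁ : Measure Ω} [IsProbabilityMeasure μ₀] [IsProbabilityMeasure μ₁]
variable {τ : TieRule Ω}

theorem abs_integral_stateInd_le {d : (V → Ω) → Bool} (hd : Measurable d) (b : Bool) :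
    |∫ x, sgn (d x.2) * stateInd b x ∂(law V μ₀ μ₁)| ≤ 1 / 2 := by
  rw [integral_mul_stateInd μ₀ μ₁ (f := fun ω => sgn (d ω)) (measurable_sgn.comp hd) (C := 1)
    (fun ω => (abs_sgn _).le), abs_mul]
  have : |∫ ω, sgn (d ω) ∂(signalLaw V μ₀ μ₁ b)| ≤ 1 :=
    abs_integral_le_integral_abs.trans (by simp [abs_sgn])
  rw [abs_of_pos (by norm_num : (0:ℝ) < 2⁻¹)]
  linarith

/-- If the actions of agents tending to infinity approximate the common limit decision uniformly,
then the limit decision, being nearly independent of itself given the state, is correct. -/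
theorem one_le_value {G : SimpleGraph V} {nb : V → Fin D → V} (hnb : IsLabelling G nb)
    {nb' : V' → Fin D → V'} {v : V'} {U : Filter ℕ} [U.NeBot] {k : ℕ → V}
    (hk : Tendsto k U cofinite) (hs : ∀ n, ∀ᶠ m in U, SameBall nb (k m) nb' v n)
    {d : (V → Ω) → Bool} {M : V → Sample V Ω → ℝ} (hL : IsLimitDecision μ₀ μ₁ τ nb d M)
    {d' : (V' → Ω) → Bool} {M' : V' → Sample V' Ω → ℝ}
    (hL' : IsLimitDecision μ₀ μ₁ τ nb' d' M') (hv : value μ₀ μ₁ d' = value μ₀ μ₁ d)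
    (hpos : 0 < value μ₀ μ₁ d)
    (hgap : ∀ i, ∀ᵐ x ∂(law V μ₀ μ₁), value μ₀ μ₁ d ≤ 2 * |M i x|) : 1 ≤ value μ₀ μ₁ d := by
  have hdm := hL.measurable_decision
  have hsd : Measurable fun ω => sgn (d ω) := measurable_sgn.comp hdm
  have hval : value μ₀ μ₁ d = _ :=
    integral_mul_sgn (V := V) μ₀ μ₁ hsd (C := 1) fun ω => (abs_sgn _).le
  set r := value μ₀ μ₁ d
  have hE (b : Bool) : 1 / 2 ≤ |∫ x, sgn (d x.2) * stateInd b x ∂(law V μ₀ μ₁)| := by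
    have hE1 := abs_integral_stateInd_le (μ₀ := μ₀) (μ₁ := μ₁) hdm b
    set E := ∫ x, sgn (d x.2) * stateInd b x ∂(law V μ₀ μ₁)
    -- Given `S = b`, this says that `d` and an independent copy of `d` agree almost surely.
    suffices h : 1 / 2 ≤ 2 * (|E| * |E|) by
      nlinarith [abs_nonneg E]
    -- Error budget: replacing the action by `d` costs `2 * ε / r` in the correlation and again `2 *
    -- ε / r` in the product of means; asymptotic independence costs `ε`.
    have hlim : Tendsto (fun ε : ℝ => 2 * (|E| * |E|) + (4 / r + 1) * ε) (𝓝[>] 0)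
        (𝓝 (2 * (|E| * |E|) + (4 / r + 1) * 0)) :=
      ((tendsto_id.mono_left nhdsWithin_le_nhds).const_mul _).const_add _
    rw [mul_zero, add_zero] at hlim
    refine ge_of_tendsto hlim ?_
    filter_upwards [self_mem_nhdsWithin] with ε hε
    have hε : 0 < ε := hε
    -- The time is chosen on the limiting network, so that this one `t` works for almost all agents
    -- `k m`; only then may `m` be sent to infinity.
    obtain ⟨t, ht⟩ := ((hL'.tendsto_integral_abs_drift v).eventually
      (lt_mem_nhds (show r - ε < value μ₀ μ₁ d' by rw [hv]; linarith))).exists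
    let a : ℕ → (V → Ω) → Bool := fun m => canonicalAction μ₀ μ₁ τ nb t (k m)
    have ham (m : ℕ) : Measurable (a m) := measurable_canonicalAction μ₀ μ₁ τ nb t (k m)
    have hasym := tendsto_asymptotic_independence μ₀ μ₁ hnb hk
      (f := fun m ω => sgn (a m ω)) (fun m => measurable_sgn.comp (ham m))
      (fun m ω => (abs_sgn _).le) (t + 1) (fun m ω ω' hω => by
        simp only [a, (canonical_local μ₀ μ₁ τ nb (k m) t ω ω' hω).2]) hdm b
    obtain ⟨m, hm, hA⟩ := ((hs (t + 1)).and
      (Metric.tendsto_nhds.1 hasym ε hε)).exists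
    have hdrift : r - ε < ∫ x, |drift μ₀ μ₁ τ nb t (k m) x| ∂(law V μ₀ μ₁) := by
      have h := hm.integral_eq μ₀ μ₁ τ (Φ := fun q => |q.2.1|)
        (measurable_fst.comp measurable_snd).abs
      dsimp only at h
      rw [h]; exact ht
    rw [Real.dist_eq, sub_zero, abs_lt] at hA
    -- the probability that the action differs from the limit decision
    let p : Sample V Ω → ℝ := fun x => 1 - sgn (a m x.2) * sgn (d x.2)
    have hp0 : ∀ x, 0 ≤ p x := fun x => by
      have : |sgn (a m x.2) * sgn (d x.2)| ≤ 1 := by rw [abs_mul, abs_sgn, abs_sgn, one_mul]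
      exact sub_nonneg.2 (le_of_abs_le this)
    have hadm : Measurable fun x : Sample V Ω => sgn (a m x.2) * sgn (d x.2) :=
      ((measurable_sgn.comp (ham m)).comp measurable_snd).mul (hsd.comp measurable_snd)
    have hadi : Integrable (fun x : Sample V Ω => sgn (a m x.2) * sgn (d x.2)) (law V μ₀ μ₁) :=
      integrable_of_abs_le hadm (C := 1) fun x => by rw [abs_mul, abs_sgn, abs_sgn, one_mul]
    have hpi : Integrable p (law V μ₀ μ₁) := (integrable_const 1).sub hadi
    have hp : ∫ x, p x ∂(law V μ₀ μ₁) ≤ 2 * ε / r := by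
      rw [le_div_iff₀ hpos]
      -- Acting at time `t` instead of waiting for `d` loses `|M| * p`, less than `ε` in mean; the
      -- gap `|M| ≥ r / 2` turns this small loss into a small probability of disagreement.
      have h1 : ∫ x, (r / 2) * p x ∂(law V μ₀ μ₁) ≤
          ∫ x, (|M (k m) x| - sgn (a m x.2) * M (k m) x) ∂(law V μ₀ μ₁) := by
        refine integral_mono_ae (hpi.const_mul _) ((hL.integrable_limit (k m)).abs.sub
          (hL.integrable_sgn_action_mul (k m) t)) ?_
        filter_upwards [hL.sgn_mul (k m), hgap (k m)] with x hx hx2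
        have hd2 : sgn (d x.2) * sgn (d x.2) = 1 := by cases d x.2 <;> simp [sgn]
        have : |M (k m) x| - sgn (a m x.2) * M (k m) x = |M (k m) x| * p x := by
          have h3 : M (k m) x = sgn (d x.2) * |M (k m) x| := by
            rw [← hx, ← mul_assoc, hd2, one_mul]
          calc |M (k m) x| - sgn (a m x.2) * M (k m) x
              = |M (k m) x| - sgn (a m x.2) * (sgn (d x.2) * |M (k m) x|) := by rw [← h3]
            _ = |M (k m) x| * p x := by simp only [p]; ring
        rw [this]
        exact mul_le_mul_of_nonneg_right (by linarith) (hp0 x)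
      rw [integral_const_mul, integral_sub (hL.integrable_limit (k m)).abs
        (hL.integrable_sgn_action_mul (k m) t), hL.integral_abs_limit,
        hL.integral_sgn_action_limit] at h1
      linarith
    have hJi : Integrable (fun x => sgn (a m x.2) * stateInd b x) (law V μ₀ μ₁) :=
      (integrable_decision μ₀ μ₁ (ham m)).mul_bdd (c := 1)
        (measurable_stateInd b).aestronglyMeasurable (ae_of_all _ fun x => abs_stateInd_le b x)
    have hEi : Integrable (fun x => sgn (d x.2) * stateInd b x) (law V μ₀ μ₁) :=
      (integrable_decision μ₀ μ₁ hdm).mul_bdd (c := 1)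
        (measurable_stateInd b).aestronglyMeasurable (ae_of_all _ fun x => abs_stateInd_le b x)
    have hKi : Integrable (fun x => sgn (a m x.2) * sgn (d x.2) * stateInd b x) (law V μ₀ μ₁) :=
      hadi.mul_bdd (c := 1)
        (measurable_stateInd b).aestronglyMeasurable (ae_of_all _ fun x => abs_stateInd_le b x)
    have hSi : Integrable (stateInd b) (law V μ₀ μ₁) :=
      integrable_of_abs_le (measurable_stateInd b) (abs_stateInd_le b)
    have hK : 1 / 2 - 2 * ε / r ≤
        ∫ x, sgn (a m x.2) * sgn (d x.2) * stateInd b x ∂(law V μ₀ μ₁) := by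
      have h1 : ∫ x, (stateInd b x - sgn (a m x.2) * sgn (d x.2) * stateInd b x)
          ∂(law V μ₀ μ₁) ≤ ∫ x, p x ∂(law V μ₀ μ₁) := by
        refine integral_mono (hSi.sub hKi) hpi fun x => ?_
        have : stateInd b x - sgn (a m x.2) * sgn (d x.2) * stateInd b x = p x * stateInd b x := by
          simp only [p]; ring
        change stateInd b x - sgn (a m x.2) * sgn (d x.2) * stateInd b x ≤ p x
        rw [this]
        exact mul_le_of_le_one_right (hp0 x) (le_of_abs_le (abs_stateInd_le b x))
      rw [integral_sub hSi hKi, integral_stateInd] at h1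
      linarith
    have hJ : |(∫ x, sgn (a m x.2) * stateInd b x ∂(law V μ₀ μ₁)) - E| ≤ 2 * ε / r := by
      rw [← integral_sub hJi hEi]
      refine abs_integral_le_integral_abs.trans
        ((integral_mono (hJi.sub hEi).abs hpi fun x => ?_).trans hp)
      have hd2 : sgn (d x.2) * sgn (d x.2) = 1 := by cases d x.2 <;> simp [sgn]
      have : sgn (a m x.2) * stateInd b x - sgn (d x.2) * stateInd b x =
          -(sgn (d x.2) * stateInd b x) * p x := by
        simp only [p]
        linear_combination (-(sgn (a m x.2) * stateInd b x)) * hd2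
      change |sgn (a m x.2) * stateInd b x - sgn (d x.2) * stateInd b x| ≤ p x
      rw [this, abs_mul, abs_neg, abs_mul, abs_sgn, one_mul, abs_of_nonneg (hp0 x)]
      exact mul_le_of_le_one_left (hp0 x) (abs_stateInd_le b x)
    set J := ∫ x, sgn (a m x.2) * stateInd b x ∂(law V μ₀ μ₁)
    have hfin : J * E ≤ |E| * |E| + 2 * ε / r * (1 / 2) := by
      have e1 : J * E = E * E + (J - E) * E := by ring
      have e2 : (J - E) * E ≤ 2 * ε / r * (1 / 2) :=
        (le_abs_self _).trans ((abs_mul _ _).trans_le (mul_le_mul hJ hE1 (abs_nonneg _)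
          ((abs_nonneg _).trans hJ)))
      rw [e1, abs_mul_abs_self]
      linarith
    have e3 : (4 / r + 1) * ε = 2 * (2 * ε / r) + ε := by ring
    have e4 := hA.2
    have e5 : 2 * J * E = 2 * (J * E) := by ring
    rw [e3]
    linarith
  have hT := hE true
  have hF := hE false
  have hT1 := le_of_abs_le (abs_integral_stateInd_le (μ₀ := μ₀) (μ₁ := μ₁) hdm true)
  have hF1 := neg_le_of_abs_le (abs_integral_stateInd_le (μ₀ := μ₀) (μ₁ := μ₁) hdm false)
  rw [hval] at hpos ⊢
  -- Both integrals are `±1/2`, and their difference is the positive value, so they are `1/2` and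
  -- `-1/2`.
  rcases le_abs.1 hT with h1 | h1 <;> rcases le_abs.1 hF with h0 | h0 <;> linarith

/-- If the agents agree in the limit on all networks, then they learn the state on all infinite
networks of bounded degree. -/
theorem Network.one_le_value (hne : μ₀ ≠ μ₁) {d : ∀ N : Network D, (N.V → Ω) → Bool}
    {M : ∀ N : Network D, N.V → Sample N.V Ω → ℝ}
    (hL : ∀ N : Network D, IsLimitDecision μ₀ μ₁ τ N.nb (d N) (M N)) (N : Network D) :
    1 ≤ value μ₀ μ₁ (d N) := by
  let U : Ultrafilter ℕ := hyperfilter ℕ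
  have hU : (U : Filter ℕ) ≤ atTop := Nat.hyperfilter_le_atTop
  have hUc : (U : Filter ℕ) ≤ cofinite := hyperfilter_le_cofinite
  -- The infimum over all networks with `D` labels is attained at the ultralimit `H` of a minimising
  -- sequence.
  let S : Set ℝ := Set.range fun N : Network D => value μ₀ μ₁ (d N)
  have hSb : BddBelow S := by
    refine ⟨0, ?_⟩
    rintro _ ⟨N, rfl⟩
    exact ((hL N).value_pos hne).le
  obtain ⟨u, -, hu, huS⟩ := exists_seq_tendsto_sInf (⟨_, N, rfl⟩ : S.Nonempty) hSb
  choose W hW using huS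
  obtain ⟨H, o, hH⟩ := exists_limit_network U W fun m => Classical.arbitrary (W m).V
  have hmin : ∀ N : Network D, value μ₀ μ₁ (d H) ≤ value μ₀ μ₁ (d N) := by
    intro N
    have h1 : Tendsto (fun m => value μ₀ μ₁ (d (W m))) U (𝓝 (sInf S)) := by
      simp only [hW]; exact hu.mono_left hU
    have h2 := value_le_of_tendsto (fun n => hH [] n) (fun m => hL (W m)) (hL H) h1
    exact h2.trans (csInf_le hSb ⟨N, rfl⟩)
  -- a limit of a minimal network along vertices tending to infinity is minimal
  have hshift : ∀ H : Network D, (∀ N : Network D, value μ₀ μ₁ (d H) ≤ value μ₀ μ₁ (d N)) →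
      ∃ (k : ℕ → H.V) (H' : Network D) (o' : H'.V), Function.Injective k ∧
        (∀ (w : List (Fin D)) (n : ℕ), ∀ᶠ m in U,
          SameBall H.nb (walk H.nb (k m) w) H'.nb (walk H'.nb o' w) n) ∧
        value μ₀ μ₁ (d H') = value μ₀ μ₁ (d H) := by
    intro H hmin
    let k : ℕ → H.V := Infinite.natEmbedding H.V
    obtain ⟨H', o', h⟩ := exists_limit_network U (fun _ => H) k
    refine ⟨k, H', o', (Infinite.natEmbedding H.V).injective, h, le_antisymm ?_ (hmin H')⟩
    exact value_le_of_tendsto (fun n => h [] n) (fun _ => hL H) (hL H') tendsto_const_nhds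
  obtain ⟨k, H', o', hk, hs, hv⟩ := hshift H hmin
  have hmin' : ∀ N : Network D, value μ₀ μ₁ (d H') ≤ value μ₀ μ₁ (d N) := fun N => by
    rw [hv]; exact hmin N
  -- The gap is available on `H'` and not on `H`, so the root is sent to infinity a second time, now
  -- inside `H'`.
  obtain ⟨k', H'', o'', hk', hs', hv'⟩ := hshift H' hmin'
  have hkU : Tendsto k U cofinite := hk.tendsto_cofinite.mono_left hUc
  have hgap : ∀ i, ∀ᵐ x ∂(law H'.V μ₀ μ₁), value μ₀ μ₁ (d H') ≤ 2 * |M H' i x| := by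
    intro i
    -- Each vertex of `H'` is the limit of the vertices reached by one word `w` from `k m`, which
    -- also tend to infinity; so the gap holds at every vertex and not only at the root.
    obtain ⟨w, rfl⟩ := exists_walk_eq H'.isLabelling H'.connected o' i
    have hkw : Tendsto (fun m => walk H.nb (k m) w) U cofinite := by
      refine le_cofinite_iff_eventually_ne.2 fun v => eventually_map.2 ?_
      filter_upwards [eventually_disjoint_ball H.isLabelling hkU {v} w.length] with m hm hmv
      exact Finset.disjoint_left.1 hm (mem_ball.2 ⟨w, le_rfl, rfl⟩) (Finset.mem_singleton.2 hmv)
    rw [hv]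
    exact ae_value_le_abs_limit H.isLabelling hkw (fun n => hs w n) (hL H) (hL H') hv
  have h1 := BayesianLearning.one_le_value H'.isLabelling (hk'.tendsto_cofinite.mono_left hUc)
    (fun n => hs' [] n) (hL H') (hL H'') hv' ((hL H').value_pos hne) hgap
  exact h1.trans (hmin' N)

end Conclusion

end BayesianLearning

/-! ### From value 1 to learning. -/

open BayesianLearning in
theorem mainTheorem2 {Ω : Type*} [MetricSpace Ω] [CompactSpace Ω] [MeasurableSpace Ω]
    [BorelSpace Ω] (μ₀ μ₁ : Measure Ω) [IsProbabilityMeasure μ₀] [IsProbabilityMeasure μ₁]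
    (h₀₁ : μ₀ ≪ μ₁) (h₁₀ : μ₁ ≪ μ₀) (hne : μ₀ ≠ μ₁) (τ : BayesianLearning.TieRule Ω)
    (hagree : BayesianLearning.AlwaysLimitAgreement μ₀ μ₁ τ)
    {V : Type} [Infinite V] (G : SimpleGraph V) [G.LocallyFinite] (hG : G.Connected)
    (hdeg : ∃ d : ℕ, ∀ i, G.degree i ≤ d) :
    BayesianLearning.LearningProbEq μ₀ μ₁ τ G 1 ∧
      ∀ᵐ x ∂(BayesianLearning.law V μ₀ μ₁), ∀ i,
        BayesianLearning.limitActions μ₀ μ₁ τ G i x = {x.1} := by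
  obtain ⟨D, hD⟩ := hdeg
  obtain ⟨nb, hnb⟩ := exists_isLabelling G hD
  have hex (N : Network (D + 1)) := exists_isLimitDecision μ₀ μ₁ τ N.isLabelling
    (hagree N.V N.G N.connected)
  choose d M hL using hex
  let N : Network (D + 1) := ⟨V, G, inferInstance, hG, inferInstance, nb, hnb⟩
  have hval : 1 ≤ value μ₀ μ₁ (d N) := Network.one_le_value hne hL N
  have hLN : IsLimitDecision μ₀ μ₁ τ nb (d N) (M N) := hL N
  have hsgn (a b : Bool) : sgn a * sgn b = 2 * (if a = b then 1 else 0) - 1 := by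
    cases a <;> cases b <;> simp [sgn] <;> norm_num
  have hle1 (f : (V → Ω) → Bool) (x : Sample V Ω) : sgn (f x.2) * sgn x.1 ≤ 1 :=
    le_of_abs_le (by rw [abs_mul, abs_sgn, abs_sgn, one_mul])
  have hi (f : (V → Ω) → Bool) (hf : Measurable f) :
      Integrable (fun x : Sample V Ω => sgn (f x.2) * sgn x.1) (law V μ₀ μ₁) :=
    integrable_of_abs_le ((measurable_sgn.comp (hf.comp measurable_snd)).mul
      (measurable_sgn.comp measurable_fst)) (C := 1) fun x => by
        rw [abs_mul, abs_sgn, abs_sgn, one_mul]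
  have hval1 : value μ₀ μ₁ (d N) = 1 := by
    refine le_antisymm ?_ hval
    refine (integral_mono (hi _ hLN.measurable_decision) (integrable_const 1) (hle1 (d N))).trans ?_
    simp
  constructor
  · intro i
    -- A decision is correct with probability `(1 + c) / 2`, where `c` is its correlation with the
    -- state; for the action at time `t` this correlation is the mean modulus of the drift.
    have hprob (t : ℕ) : probCorrect μ₀ μ₁ τ G i t =
        (1 + ∫ x, |drift μ₀ μ₁ τ nb t i x| ∂(law V μ₀ μ₁)) / 2 := by
      have hset : MeasurableSet {x : Sample V Ω | action μ₀ μ₁ τ G t i x = x.1} :=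
        measurableSet_eq_fun (measurable_action μ₀ μ₁ τ G t i).2 measurable_fst
      have hind : ∫ x, sgn (canonicalAction μ₀ μ₁ τ nb t i x.2) * sgn x.1 ∂(law V μ₀ μ₁) =
          ∫ x, (2 * Set.indicator {x : Sample V Ω | action μ₀ μ₁ τ G t i x = x.1}
            (fun _ => (1 : ℝ)) x - 1) ∂(law V μ₀ μ₁) := by
        refine integral_congr_ae ?_
        filter_upwards [action_ae_eq_canonicalAction μ₀ μ₁ τ hnb t i] with x hx
        rw [hsgn, ← hx]
        simp [Set.indicator]
      rw [← hLN.integral_sgn_action i t, hind, integral_sub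
        (((integrable_const (1 : ℝ)).indicator hset).const_mul 2) (integrable_const 1),
        integral_const_mul, integral_indicator hset, probCorrect]
      simp
    have h := ((hLN.tendsto_integral_abs_drift i).const_add 1).div_const 2
    rw [hval1] at h
    norm_num at h
    exact h.congr fun t => (hprob t).symm
  · obtain ⟨A, -, hA⟩ := hagree V G hG
    -- One agent suffices, since agreement carries its limit action to all others.
    let i : V := Classical.arbitrary V
    have hdS : ∀ᵐ x ∂(law V μ₀ μ₁), sgn (d N x.2) * sgn x.1 = 1 := by
      have h0 : ∫ x, (1 - sgn (d N x.2) * sgn x.1) ∂(law V μ₀ μ₁) = 0 := by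
        rw [integral_sub (integrable_const 1) (hi _ hLN.measurable_decision)]
        change _ - value μ₀ μ₁ (d N) = 0
        simp [hval1]
      have := (integral_eq_zero_iff_of_nonneg (fun x => sub_nonneg.2 (hle1 (d N) x))
        ((integrable_const 1).sub (hi _ hLN.measurable_decision))).1 h0
      exact this.mono fun x hx => (sub_eq_zero.1 hx).symm
    have hM1 : ∀ᵐ x ∂(law V μ₀ μ₁), |M N i x| = 1 := by
      have h0 : ∫ x, (1 - |M N i x|) ∂(law V μ₀ μ₁) = 0 := by
        rw [integral_sub (integrable_const 1) (hLN.integrable_limit i).abs,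
          hLN.integral_abs_limit i, hval1]
        simp
      have := (integral_eq_zero_iff_of_nonneg_ae
        ((hLN.abs_limit_le i).mono fun x hx => sub_nonneg.2 hx)
        ((integrable_const 1).sub (hLN.integrable_limit i).abs)).1 h0
      exact this.mono fun x hx => (sub_eq_zero.1 hx).symm
    have hact : ∀ᵐ x ∂(law V μ₀ μ₁), ∀ t, action μ₀ μ₁ τ G t i x =
        canonicalAction μ₀ μ₁ τ nb t i x.2 :=
      ae_all_iff.2 fun t => action_ae_eq_canonicalAction μ₀ μ₁ τ hnb t i
    filter_upwards [hA, hdS, hM1, hLN.sgn_mul i, hLN.tendsto i, hact] with x hx hx1 hx2 hx3 hx4 hx5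
    intro j
    rw [hx j, ← hx i, limitActions_eq_singleton]
    -- As `d = S` and `|M| = 1` almost surely, the drift multiplied by the sign of `S` tends to 1;
    -- once it is positive, the action equals `S`.
    have hlim := hx4.const_mul (sgn x.1)
    have h1 : sgn x.1 * M N i x = 1 := by
      rw [hx2] at hx3
      generalize sgn (d N x.2) = e at hx1 hx3
      have hs : sgn x.1 * sgn x.1 = 1 := by cases x.1 <;> simp [sgn]
      have he : e = sgn x.1 := by linear_combination sgn x.1 * hx1 - e * hs
      rw [← he]; exact hx3
    rw [h1] at hlim
    filter_upwards [hlim.eventually (lt_mem_nhds one_pos)] with t ht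
    rw [hx5 t]
    have h2 := sgn_mul_drift μ₀ μ₁ τ nb t i x
    have h3 := abs_nonneg (drift μ₀ μ₁ τ nb t i x)
    rw [← h2] at h3
    cases ha : canonicalAction μ₀ μ₁ τ nb t i x.2 <;> cases hb : x.1 <;>
      simp only [ha, hb, sgn] at h3 ht ⊢ <;> simp at h3 ht <;> linarith
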